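/- Let $n\ge 3$ and $k\ge 3$ be integers and let $\alpha>1$ be real. A block of a (finite, simple) graph is a cut edge or a maximal 2-connected subgraph; a $k$-polygon is a cycle of length $k$; a $k$-polygonal cactus is a connected graph in which every block is a $k$-polygon. Put $SO_\alpha(G)=\sum_{uv\in E(G)}\big(d(u)^\alpha+d(v)^\alpha\big)^{1/\alpha}$, where $d$ denotes the degree in $G$. Then for every $k$-polygonal cactus $G$ with exactly $n$ polygons, $$SO_\alpha(G)\ \ge\ (4n-4)(2^\alpha+4^\alpha)^{1/\alpha}+2(nk-4n+4)2^{1/\alpha}+\Big(6\cdot 2^{1/\alpha}-2(2^\alpha+4^\alpha)^{1/\alpha}\Big)\Big(n-2+\Big\lfloor\frac{n-2}{k-1}\Big\rfloor\Big),$$ and equality holds if and only if $G$ is a nice-saturated chemical cactus. Here a $k$-polygonal cactus with $n$ polygons is called a chemical cactus if it has no vertex of degree greater than $4$; a polygon of it is saturated if all its vertices are cut vertices; and a chemical cactus $G$ with $n$ $k$-polygons is nice-saturated if (1) no chemical cactus with $n$ $k$-polygons has more saturated polygons than $G$, and (2) on each polygon of $G$ the cut vertices are consecutive along the polygon. -/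

import Mathlib

namespace Cactus

universe u

variable {V : Type u}

/-- The vertex `v` is a cut vertex of the connected graph `G`: deleting it disconnects `G`.
(`Preconnected` is used so that the empty graph does not count as disconnected.) -/
def IsCutVertex (G : SimpleGraph V) (v : V) : Prop :=
  ¬ (G.induce {v}ᶜ).Preconnected

/-- A graph is 2-connected if it has at least three vertices, is connected and has
no cut vertex. -/
def IsTwoConnected (G : SimpleGraph V) : Prop :=
  3 ≤ ENat.card V ∧ G.Connected ∧ ∀ v : V, ¬ IsCutVertex G v

/-- A block of `G`: a cut edge (with its two ends) or a maximal 2-connected subgraph. -/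
def IsBlock (G : SimpleGraph V) (B : G.Subgraph) : Prop :=
  (∃ (u v : V) (h : G.Adj u v), G.IsBridge s(u, v) ∧ B = G.subgraphOfAdj h) ∨
    Maximal (fun C : G.Subgraph => IsTwoConnected C.coe) B

/-- A `k`-polygon of `G` (for `3 ≤ k`): a subgraph that is a cycle of length `k`. -/
def IsPolygon (G : SimpleGraph V) (k : ℕ) (C : G.Subgraph) : Prop :=
  Nonempty (SimpleGraph.cycleGraph k ≃g C.coe)

/-- A `k`-polygonal cactus: a connected graph in which every block is a `k`-polygon. -/
def IsPolygonalCactus (G : SimpleGraph V) (k : ℕ) : Prop :=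
  G.Connected ∧ ∀ B : G.Subgraph, IsBlock G B → IsPolygon G k B

/-- The class of `k`-polygonal cacti with exactly `n` polygons. -/
def InClass (G : SimpleGraph V) (n k : ℕ) : Prop :=
  IsPolygonalCactus G k ∧ {C : G.Subgraph | IsPolygon G k C}.ncard = n

open Classical in
/-- The `α`-Sombor index `∑ (d(u) ^ α + d(v) ^ α) ^ (1 / α)`, the sum over all edges `uv`. -/
noncomputable def sombor [Fintype V] (G : SimpleGraph V) (α : ℝ) : ℝ :=
  ∑ e ∈ G.edgeFinset, Sym2.lift
    ⟨fun u v : V => ((G.degree u : ℝ) ^ α + (G.degree v : ℝ) ^ α) ^ (1 / α),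
      fun u v => congrArg (fun x : ℝ => x ^ (1 / α)) (add_comm _ _)⟩ e

open Classical in
/-- A chemical `(n, k)`-cactus: a `k`-polygonal cactus with `n` polygons and no vertex of
degree greater than 4. -/
def IsChemicalCactus [Fintype V] (G : SimpleGraph V) (n k : ℕ) : Prop :=
  InClass G n k ∧ ∀ v : V, G.degree v ≤ 4

/-- A saturated polygon: all its vertices are cut vertices of `G`. -/
def IsSaturatedPolygon (G : SimpleGraph V) (k : ℕ) (C : G.Subgraph) : Prop :=
  IsPolygon G k C ∧ ∀ v ∈ C.verts, IsCutVertex G v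

/-- The number of saturated polygons of `G`. -/
noncomputable def numSaturated (G : SimpleGraph V) (k : ℕ) : ℕ :=
  {C : G.Subgraph | IsSaturatedPolygon G k C}.ncard

/-- The cut vertices of `G` on the `k`-polygon `C` are successively arranged: for some way of
numbering the vertices of `C` by `0, …, k - 1` around the cycle, the cut vertices are exactly
the first `m` ones, for some `m`. -/
def CutVerticesConsecutive (G : SimpleGraph V) (k : ℕ) (C : G.Subgraph) : Prop :=
  ∃ (φ : SimpleGraph.cycleGraph k ≃g C.coe) (m : ℕ),
    ∀ i : Fin k, IsCutVertex G (φ i : V) ↔ (i : ℕ) < m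

/-- A nice-saturated chemical `(n, k)`-cactus: it has the largest number of saturated polygons
among all chemical `(n, k)`-cacti, and the cut vertices on each of its polygons are
successively arranged. -/
def IsNiceSaturated [Fintype V] (G : SimpleGraph V) (n k : ℕ) : Prop :=
  IsChemicalCactus G n k ∧
    (∀ (W : Type u) [Fintype W] (H : SimpleGraph W),
      IsChemicalCactus H n k → numSaturated H k ≤ numSaturated G k) ∧
    ∀ C : G.Subgraph, IsPolygon G k C → CutVerticesConsecutive G k C

end Cactus

/-! ### Two-connected subgraphs -/

namespace Cactus

open SimpleGraph

variable {V : Type*} {G : SimpleGraph V}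

/-! Write `A = 2 ^ (1 / α)`, let `p(v)` be the number of polygons through `v`, and call an edge
mixed if exactly one of its ends is a cut vertex. Polygons are the blocks, so `d(v) = 2 p(v)`
(`degree_eq`), and `v` is a cut vertex iff `p(v) ≥ 2` (`isCutVertex_iff`).

By Minkowski's inequality an edge `uv` weighs at least `A / 2 * (d(u) + d(v))`, and a mixed edge at
least `excess α > 0` more; both are equalities when the degrees are 2 or 4. Summing, the index is at
least `A / 2 * ∑ d(v) ^ 2 + excess α * (number of mixed edges)` (`le_sombor_of_degrees`).

Both terms are then minimised separately. Since `∑ p(v) = nk` and `|V| = n(k - 1) + 1`, the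
inequality `(p - 1)(p - 2) ≥ 0` bounds `∑ d(v) ^ 2`, with equality iff all degrees are at most 4
(`sum_degree_sq`). A polygon that is not saturated has at least two mixed edges, a saturated one has
none, and no polygon has more than two iff the cut vertices are consecutive on each
(`sum_numMixed_ge`). Counting incidences of cut vertices with polygons gives at most `⌊(n - 2) / (k
- 1)⌋` saturated polygons (`numSaturated_mul_le`). A cactus grown breadth-first attains this number
(`exists_isChemicalCactus`), so condition (1) of nice-saturation says exactly that the number is
attained. -/

lemma mem_of_reachable {H : SimpleGraph V} {S : Set V}
    (hS : ∀ a b, H.Adj a b → a ∈ S → b ∈ S) {x y : V} (h : H.Reachable x y) (hx : x ∈ S) :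
    y ∈ S := by
  obtain ⟨p⟩ := h
  induction p with
  | nil => exact hx
  | cons hab _ ih => exact ih (hS _ _ hab hx)

lemma not_isCutVertex_iff {v : V} :
    ¬ IsCutVertex G v ↔
      ∀ x y, x ≠ v → y ≠ v → (G.deleteIncidenceSet v).Reachable x y := by
  unfold IsCutVertex
  rw [not_not]
  constructor
  · intro h x y hx hy
    exact (h ⟨x, hx⟩ ⟨y, hy⟩).map (⟨Subtype.val, fun {a b} hab =>
      deleteIncidenceSet_adj.2 ⟨hab, a.2, b.2⟩⟩ : G.induce {v}ᶜ →g G.deleteIncidenceSet v)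
  · rintro h ⟨x, hx⟩ ⟨y, hy⟩
    have := mem_of_reachable (S := {y | ∃ hy : y ∈ ({v}ᶜ : Set V),
      (G.induce {v}ᶜ).Reachable ⟨x, hx⟩ ⟨y, hy⟩}) ?_ (h x y hx hy) ⟨hx, .refl _⟩
    · exact this.2
    · rintro a b hab ⟨ha, hr⟩
      obtain ⟨h1, -, h3⟩ := deleteIncidenceSet_adj.1 hab
      exact ⟨h3, hr.trans (Adj.reachable (by simpa using h1))⟩

/-- Two vertices of the subgraph `B` are joined by a walk in `B` that avoids `w`. -/
def ReachAvoid (B : G.Subgraph) (w x y : V) : Prop :=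
  (B.spanningCoe.deleteIncidenceSet w).Reachable x y

lemma ReachAvoid.mono {B C : G.Subgraph} (h : B ≤ C) {w x y : V} (hB : ReachAvoid B w x y) :
    ReachAvoid C w x y :=
  Reachable.mono (fun a b hab => by
    rw [deleteIncidenceSet_adj] at hab ⊢
    exact ⟨h.2 hab.1, hab.2⟩) hB

lemma ReachAvoid.symm {B : G.Subgraph} {w x y : V} (h : ReachAvoid B w x y) :
    ReachAvoid B w y x := Reachable.symm h

lemma ReachAvoid.trans {B : G.Subgraph} {w x y z : V} (h : ReachAvoid B w x y)
    (h' : ReachAvoid B w y z) : ReachAvoid B w x z := Reachable.trans h h'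

lemma ReachAvoid.refl (B : G.Subgraph) (w x : V) : ReachAvoid B w x x := Reachable.refl _

lemma ReachAvoid.of_adj {B : G.Subgraph} {w x y : V} (h : B.Adj x y) (hx : x ≠ w) (hy : y ≠ w) :
    ReachAvoid B w x y :=
  Adj.reachable (deleteIncidenceSet_adj.2 ⟨h, hx, hy⟩)

lemma ReachAvoid.mem_of_closed {B : G.Subgraph} {w : V} {S : Set V}
    (hS : ∀ a b, B.Adj a b → a ≠ w → b ≠ w → a ∈ S → b ∈ S) {x y : V}
    (h : ReachAvoid B w x y) (hx : x ∈ S) : y ∈ S :=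
  mem_of_reachable (fun a b hab =>
    let h' := deleteIncidenceSet_adj.1 hab
    hS a b h'.1 h'.2.1 h'.2.2) h hx

lemma coe_reachable_of_reachable {B : G.Subgraph} {w x y : V} (hx : x ∈ B.verts)
    (h : ReachAvoid B w x y) :
    ∃ hy : y ∈ B.verts, B.coe.Reachable ⟨x, hx⟩ ⟨y, hy⟩ := by
  refine h.mem_of_closed (S := {y | ∃ hy : y ∈ B.verts, B.coe.Reachable ⟨x, hx⟩ ⟨y, hy⟩})
    ?_ ⟨hx, .refl _⟩
  rintro a b hab - - ⟨ha, hr⟩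
  exact ⟨hab.snd_mem, hr.trans (Adj.reachable (by simpa using hab))⟩

lemma exists_ne_ne_of_three_le_encard {S : Set V} (h : 3 ≤ S.encard) (x y : V) :
    ∃ w ∈ S, w ≠ x ∧ w ≠ y := by
  by_contra! hcon
  have hsub : S ⊆ {x, y} := fun w hw => by
    by_cases hwx : w = x
    · simp [hwx]
    · simp [hcon w hw hwx]
  have := (h.trans (Set.encard_le_encard hsub)).trans (Set.encard_insert_le _ _)
  rw [Set.encard_singleton] at this
  exact absurd this (by decide)

/-- Here `w` ranges over all of `V`: a `w` outside `B` expresses connectedness, a `w` in `B` the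
absence of cut vertices. Conversely, connectedness follows by deleting a third vertex. -/
lemma isTwoConnected_coe_iff {B : G.Subgraph} :
    IsTwoConnected B.coe ↔ 3 ≤ B.verts.encard ∧
      ∀ w x y, x ∈ B.verts → y ∈ B.verts → x ≠ w → y ≠ w → ReachAvoid B w x y := by
  unfold IsTwoConnected
  rw [ENat.card_coe_set_eq]
  refine and_congr_right fun h3 => ⟨?_, ?_⟩
  · rintro ⟨hc, hv⟩ w x y hx hy hxw hyw
    by_cases hw : w ∈ B.verts
    · have := not_isCutVertex_iff.1 (hv ⟨w, hw⟩) ⟨x, hx⟩ ⟨y, hy⟩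
        (by simpa using hxw) (by simpa using hyw)
      exact this.map (⟨Subtype.val, fun {a b} hab => by
        rw [deleteIncidenceSet_adj] at hab ⊢
        simpa [Subtype.ext_iff] using hab⟩ : B.coe.deleteIncidenceSet ⟨w, hw⟩ →g
          B.spanningCoe.deleteIncidenceSet w)
    · have := hc.preconnected ⟨x, hx⟩ ⟨y, hy⟩
      exact this.map (⟨Subtype.val, fun {a b} hab => by
        rw [deleteIncidenceSet_adj]
        refine ⟨by simpa using hab, ?_, ?_⟩
        · rintro rfl; exact hw a.2
        · rintro rfl; exact hw b.2⟩ : B.coe →g B.spanningCoe.deleteIncidenceSet w)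
  · intro h
    refine ⟨(connected_iff _).2 ⟨?_, ?_⟩, ?_⟩
    · rintro ⟨x, hx⟩ ⟨y, hy⟩
      obtain ⟨w, -, hwx, hwy⟩ := exists_ne_ne_of_three_le_encard h3 x y
      exact (coe_reachable_of_reachable hx (h w x y hx hy hwx.symm hwy.symm)).2
    · have : B.verts.Nonempty := by
        rw [← Set.encard_pos]
        exact lt_of_lt_of_le (by decide) h3
      exact this.to_subtype
    · rintro ⟨w, hw⟩
      rw [not_isCutVertex_iff]
      rintro ⟨x, hx⟩ ⟨y, hy⟩ hxw hyw
      have hxw' : x ≠ w := by simpa using hxw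
      have hyw' : y ≠ w := by simpa using hyw
      refine ((h w x y hx hy hxw' hyw').mem_of_closed (S := {y | ∃ hy : y ∈ B.verts,
        (B.coe.deleteIncidenceSet ⟨w, hw⟩).Reachable ⟨x, hx⟩ ⟨y, hy⟩}) ?_ ⟨hx, .refl _⟩).2
      rintro a b hab haw hbw ⟨ha, hr⟩
      exact ⟨hab.snd_mem, hr.trans (Adj.reachable (deleteIncidenceSet_adj.2
        ⟨by simpa using hab, by simpa using haw, by simpa using hbw⟩))⟩

/-- Two 2-connected subgraphs with two common vertices have a 2-connected union. -/
lemma IsTwoConnected.sup {B C : G.Subgraph} (hB : IsTwoConnected B.coe)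
    (hC : IsTwoConnected C.coe) {a b : V} (hab : a ≠ b) (haB : a ∈ B.verts) (haC : a ∈ C.verts)
    (hbB : b ∈ B.verts) (hbC : b ∈ C.verts) : IsTwoConnected (B ⊔ C).coe := by
  rw [isTwoConnected_coe_iff] at *
  refine ⟨hB.1.trans (Set.encard_le_encard (by simp)), fun w x y hx hy hxw hyw => ?_⟩
  obtain ⟨z, hzB, hzC, hzw⟩ : ∃ z, z ∈ B.verts ∧ z ∈ C.verts ∧ z ≠ w := by
    by_cases h : a = w
    · exact ⟨b, hbB, hbC, fun h' => hab (h.trans h'.symm)⟩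
    · exact ⟨a, haB, haC, h⟩
  have key : ∀ x, x ∈ (B ⊔ C).verts → x ≠ w → ReachAvoid (B ⊔ C) w x z := by
    rintro x (hx | hx) hxw
    · exact (hB.2 w x z hx hzB hxw hzw).mono le_sup_left
    · exact (hC.2 w x z hx hzC hxw hzw).mono le_sup_right
  exact (key x hx hxw).trans (key y hy hyw).symm

/-- On a path, every vertex other than `w` is joined to an end by a part of the path
avoiding `w`. -/
lemma reachAvoid_of_isPath {a b : V} (p : G.Walk a b) (hp : p.IsPath) {w x : V}
    (hx : x ∈ p.support) (hxw : x ≠ w) :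
    ReachAvoid p.toSubgraph w x a ∨ ReachAvoid p.toSubgraph w x b := by
  induction p with
  | nil =>
    simp only [Walk.support_nil, List.mem_singleton] at hx
    subst hx
    exact .inl (.refl _ _ _)
  | @cons a c b hac p ih =>
    rw [Walk.cons_isPath_iff] at hp
    have hle : p.toSubgraph ≤ (Walk.cons hac p).toSubgraph := by
      rw [Walk.toSubgraph]; exact le_sup_right
    have hadj : (Walk.cons hac p).toSubgraph.Adj a c := by simp [Walk.toSubgraph]
    by_cases hxa : x = a
    · subst hxa
      exact .inl (.refl _ _ _)
    · have hx' : x ∈ p.support := by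
        rw [Walk.support_cons, List.mem_cons] at hx
        exact hx.resolve_left hxa
      by_cases hwa : w = a
      · subst hwa
        have hw : ∀ z ∈ p.support, z ≠ w := fun z hz h => hp.2 (h ▸ hz)
        right
        have hr : p.toSubgraph.coe.Reachable ⟨x, by simpa using hx'⟩ ⟨b, by simp⟩ :=
          (p.toSubgraph_connected.coe).preconnected _ _
        refine Reachable.map (⟨Subtype.val, fun {u v} huv => ?_⟩ : p.toSubgraph.coe →g
          ((Walk.cons hac p).toSubgraph.spanningCoe).deleteIncidenceSet w) hr
        rw [deleteIncidenceSet_adj]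
        exact ⟨hle.2 (by simpa using huv), hw _ (by simpa using u.2), hw _ (by simpa using v.2)⟩
      · rcases ih hp.1 hx' with h | h
        -- A walk that avoids `w` and starts at `x ≠ w` cannot end at `w`.
        · by_cases hcw : c = w
          · left
            exfalso
            subst hcw
            have : x ∈ ({c}ᶜ : Set V) := hxw
            exact ReachAvoid.mem_of_closed (S := ({c}ᶜ : Set V)) (fun _ _ _ _ h _ => h) h this rfl
          · exact .inl ((h.mono hle).trans (.of_adj hadj.symm hcw (Ne.symm hwa)))
        · exact .inr (h.mono hle)

/-- In a 2-connected subgraph, every edge can be bypassed. -/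
lemma IsTwoConnected.reachable_deleteEdges {B : G.Subgraph} (hB : IsTwoConnected B.coe) {u v : V}
    (h : B.Adj u v) : (B.spanningCoe.deleteEdges {s(u, v)}).Reachable u v := by
  rw [isTwoConnected_coe_iff] at hB
  -- Go from `u` to a third vertex `w` avoiding `v`, then from `w` to `v` avoiding `u`; neither leg
  -- can use the edge `uv`.
  obtain ⟨w, hw, hwu, hwv⟩ := exists_ne_ne_of_three_le_encard hB.1 u v
  have h1 := hB.2 v u w h.fst_mem hw h.ne hwv
  have h2 := hB.2 u w v hw h.snd_mem hwu h.ne.symm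
  refine Reachable.trans (Reachable.mono ?_ h1) (Reachable.mono ?_ h2) <;>
  · intro a b hab
    rw [deleteIncidenceSet_adj] at hab
    rw [deleteEdges_adj]
    refine ⟨hab.1, ?_⟩
    rw [Set.mem_singleton_iff, Sym2.eq_iff]
    have := hab.2
    tauto

lemma IsTwoConnected.not_isBridge {B : G.Subgraph} (hB : IsTwoConnected B.coe) {u v : V}
    (h : B.Adj u v) : ¬ G.IsBridge s(u, v) := by
  rw [isBridge_iff, not_not]
  exact (hB.reachable_deleteEdges h).mono (deleteEdges_mono B.spanningCoe_le)

/-- A path that bypasses the edge forms a cycle with it. After deleting `w`, each vertex still runs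
along the path to `u` or to `v`, and the edge joins these two ends. -/
lemma exists_isTwoConnected_of_not_isBridge {u v : V} (huv : G.Adj u v)
    (h : ¬ G.IsBridge s(u, v)) : ∃ B : G.Subgraph, IsTwoConnected B.coe ∧ B.Adj u v := by
  classical
  rw [isBridge_iff, not_not] at h
  obtain ⟨q, hq⟩ := h.exists_isPath
  set p := q.mapLe (G.deleteEdges_le {s(u, v)}) with hpdef
  have hp : p.IsPath := hq.mapLe _
  have hnot : s(u, v) ∉ p.edges := by
    rw [hpdef, Walk.edges_mapLe_eq_edges]
    intro hmem
    have := q.edges_subset_edgeSet hmem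
    simp at this
  let E := G.subgraphOfAdj huv
  refine ⟨p.toSubgraph ⊔ E, ?_, by simp [E]⟩
  have hverts : (p.toSubgraph ⊔ E).verts = {z | z ∈ p.support} := by
    ext z
    simp only [Subgraph.verts_sup, Set.mem_union, Walk.mem_verts_toSubgraph, E,
      subgraphOfAdj_verts, Set.mem_insert_iff, Set.mem_singleton_iff, Set.mem_ofPred_eq]
    constructor
    · rintro (h | rfl | rfl) <;> simp_all
    · exact Or.inl
  rw [isTwoConnected_coe_iff]
  constructor
  · rw [hverts]
    clear_value p
    cases p with
    | nil => exact absurd rfl huv.ne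
    | @cons _ c _ hac r =>
      have hcv : c ≠ v := by
        rintro rfl
        simp at hnot
      have hsub : ({u, c, v} : Set V) ⊆ {z | z ∈ (Walk.cons hac r).support} := by
        rintro z (rfl | rfl | rfl) <;> simp
      refine le_trans (le_of_eq ?_) (Set.encard_le_encard hsub)
      rw [Set.encard_insert_of_notMem, Set.encard_pair hcv]
      · rfl
      · simp [hac.ne, huv.ne]
  · have key : ∀ w x, x ∈ p.support → x ≠ w →
        ReachAvoid (p.toSubgraph ⊔ E) w x u ∨ ReachAvoid (p.toSubgraph ⊔ E) w x v := by
      intro w x hx hxw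
      exact (reachAvoid_of_isPath p hp hx hxw).imp (·.mono le_sup_left) (·.mono le_sup_left)
    have hend : ∀ {w x z}, x ≠ w → ReachAvoid (p.toSubgraph ⊔ E) w x z → z ≠ w := by
      intro w x z hx h
      exact h.mem_of_closed (S := {w}ᶜ) (fun _ _ _ _ h _ => h) hx
    have hE : (p.toSubgraph ⊔ E).Adj u v := by simp [E]
    intro w x y hx hy hxw hyw
    rw [hverts] at hx hy
    rcases key w x hx hxw with h1 | h1 <;> rcases key w y hy hyw with h2 | h2
    · exact h1.trans h2.symm
    · exact (h1.trans (.of_adj hE (hend hxw h1) (hend hyw h2))).trans h2.symm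
    · exact (h1.trans (.of_adj hE.symm (hend hxw h1) (hend hyw h2))).trans h2.symm
    · exact h1.trans h2.symm

/-- Two 2-connected subgraphs with a common vertex `v`, joined by a path avoiding `v`, have
a common 2-connected extension. -/
lemma exists_isTwoConnected_of_reachable {B C : G.Subgraph} (hB : IsTwoConnected B.coe)
    (hC : IsTwoConnected C.coe) {v a b : V} (hvB : v ∈ B.verts) (hvC : v ∈ C.verts)
    (haB : a ∈ B.verts) (hbC : b ∈ C.verts) (hav : a ≠ v) (hbv : b ≠ v)
    (h : (G.deleteIncidenceSet v).Reachable a b) :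
    ∃ D : G.Subgraph, IsTwoConnected D.coe ∧ B ≤ D ∧ C ≤ D := by
  classical
  obtain ⟨q, hq⟩ := h.exists_isPath
  have hqv : ∀ z ∈ q.support, z ≠ v := by
    intro z hz
    exact mem_of_reachable (S := {v}ᶜ)
      (fun a b hab _ => (deleteIncidenceSet_adj.1 hab).2.2) ⟨q.takeUntil z hz⟩ hav
  set p := q.mapLe (G.deleteIncidenceSet_le v) with hpdef
  have hp : p.IsPath := hq.mapLe _
  have hpv : ∀ z ∈ p.support, z ≠ v := by
    intro z hz
    rw [hpdef, Walk.support_mapLe_eq_support] at hz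
    exact hqv z hz
  let D := B ⊔ C ⊔ p.toSubgraph
  have hBD : B ≤ D := le_sup_left.trans le_sup_left
  have hCD : C ≤ D := le_sup_right.trans le_sup_left
  have hpD : p.toSubgraph ≤ D := le_sup_right
  refine ⟨D, ?_, hBD, hCD⟩
  rw [isTwoConnected_coe_iff] at *
  refine ⟨hB.1.trans (Set.encard_le_encard hBD.1), fun w x y hx hy hxw hyw => ?_⟩
  have hpath : ∀ w x, x ∈ p.support → x ≠ w → ReachAvoid D w x a ∨ ReachAvoid D w x b :=
    fun w x hx hxw =>
      (reachAvoid_of_isPath p hp hx hxw).imp (·.mono hpD) (·.mono hpD)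
  have hend : ∀ {w x z}, x ≠ w → ReachAvoid D w x z → z ≠ w := by
    intro w x z hx h
    exact h.mem_of_closed (S := {w}ᶜ) (fun _ _ _ _ h _ => h) hx
  -- The meeting point is the shared vertex `v`, unless `v` itself is deleted; then it is `a`,
  -- reached from `C` through the path, which avoids `v`.
  obtain ⟨z, hz⟩ : ∃ z, ∀ x ∈ B.verts ∪ C.verts, x ≠ w → ReachAvoid D w x z := by
    by_cases hwv : v = w
    · refine ⟨a, ?_⟩
      rintro x (hx | hx) hxw
      · exact (hB.2 w x a hx haB hxw (hwv ▸ hav)).mono hBD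
      · refine ((hC.2 w x b hx hbC hxw (hwv ▸ hbv)).mono hCD).trans ?_
        have hr : p.toSubgraph.coe.Reachable ⟨b, by simp⟩ ⟨a, by simp⟩ :=
          (p.toSubgraph_connected.coe).preconnected _ _
        refine Reachable.map (⟨Subtype.val, fun {u u'} huv => ?_⟩ : p.toSubgraph.coe →g
          D.spanningCoe.deleteIncidenceSet w) hr
        rw [deleteIncidenceSet_adj]
        exact ⟨hpD.2 (by simpa using huv), hwv ▸ hpv _ (by simpa using u.2),
          hwv ▸ hpv _ (by simpa using u'.2)⟩
    · refine ⟨v, ?_⟩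
      rintro x (hx | hx) hxw
      · exact (hB.2 w x v hx hvB hxw hwv).mono hBD
      · exact (hC.2 w x v hx hvC hxw hwv).mono hCD
  have key : ∀ x ∈ D.verts, x ≠ w → ReachAvoid D w x z := by
    rintro x (hx | hx) hxw
    · exact hz x hx hxw
    · rcases hpath w x (by simpa using hx) hxw with h1 | h1
      · exact h1.trans (hz a (.inl haB) (hend hxw h1))
      · exact h1.trans (hz b (.inr hbC) (hend hxw h1))
  exact (key x hx hxw).trans (key y hy hyw).symm

end Cactus

/-! ### Polygons and cyclic numberings of their vertices -/

namespace Cactus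

open SimpleGraph
open scoped Fin.NatCast

variable {V : Type*} {G : SimpleGraph V}

/-- `c` numbers the vertices of the polygon `C` around the cycle. -/
structure IsNumbering {m : ℕ} (C : G.Subgraph) (c : Fin (m + 3) → V) : Prop where
  inj : Function.Injective c
  verts : C.verts = Set.range c
  adj : ∀ a b, C.Adj a b ↔ ∃ i, (c i = a ∧ c (i + 1) = b) ∨ (c (i + 1) = a ∧ c i = b)

lemma cycleGraph_adj_iff {m : ℕ} {i j : Fin (m + 3)} :
    (cycleGraph (m + 3)).Adj i j ↔ i + 1 = j ∨ j + 1 = i := by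
  rw [cycleGraph_adj, sub_eq_iff_eq_add', sub_eq_iff_eq_add', or_comm, eq_comm, @eq_comm _ i]

lemma isNumbering_of_iso {m : ℕ} {C : G.Subgraph} (φ : cycleGraph (m + 3) ≃g C.coe) :
    IsNumbering C (fun i => (φ i : V)) where
  inj := Subtype.val_injective.comp φ.injective
  verts := by
    ext v
    constructor
    · intro hv
      obtain ⟨i, hi⟩ := φ.surjective ⟨v, hv⟩
      exact ⟨i, by simp [hi]⟩
    · rintro ⟨i, rfl⟩
      exact (φ i).2
  adj := by
    intro a b
    constructor
    · intro h
      obtain ⟨i, hi⟩ := φ.surjective ⟨a, h.fst_mem⟩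
      obtain ⟨j, hj⟩ := φ.surjective ⟨b, h.snd_mem⟩
      have : C.coe.Adj (φ i) (φ j) := by rw [hi, hj]; simpa using h
      rw [φ.map_adj_iff, cycleGraph_adj_iff] at this
      rcases this with rfl | rfl
      · exact ⟨i, .inl ⟨by simp [hi], by simp [hj]⟩⟩
      · exact ⟨j, .inr ⟨by simp [hi], by simp [hj]⟩⟩
    · have key : ∀ i, C.Adj (φ i) (φ (i + 1)) := fun i => by
        have : C.coe.Adj (φ i) (φ (i + 1)) := by
          rw [φ.map_adj_iff, cycleGraph_adj_iff]; exact .inl rfl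
        simpa using this
      rintro ⟨i, ⟨rfl, rfl⟩ | ⟨rfl, rfl⟩⟩
      · exact key i
      · exact (key i).symm

lemma IsNumbering.exists_iso {m : ℕ} {C : G.Subgraph} {c : Fin (m + 3) → V}
    (h : IsNumbering C c) : ∃ φ : cycleGraph (m + 3) ≃g C.coe, ∀ i, (φ i : V) = c i := by
  have hmem : ∀ i, c i ∈ C.verts := fun i => h.verts ▸ ⟨i, rfl⟩
  refine ⟨⟨Equiv.ofBijective (fun i => ⟨c i, hmem i⟩) ⟨?_, ?_⟩, ?_⟩, fun _ => rfl⟩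
  · intro i j hij
    exact h.inj (by simpa using hij)
  · rintro ⟨v, hv⟩
    rw [h.verts] at hv
    obtain ⟨i, rfl⟩ := hv
    exact ⟨i, rfl⟩
  · intro i j
    change C.Adj (c i) (c j) ↔ _
    simp only [h.adj, cycleGraph_adj_iff, h.inj.eq_iff]
    constructor
    · rintro ⟨l, ⟨rfl, rfl⟩ | ⟨rfl, rfl⟩⟩ <;> simp
    · rintro (rfl | rfl)
      · exact ⟨i, .inl ⟨rfl, rfl⟩⟩
      · exact ⟨j, .inr ⟨rfl, rfl⟩⟩

lemma isPolygon_iff_exists_isNumbering {m : ℕ} {C : G.Subgraph} :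
    IsPolygon G (m + 3) C ↔ ∃ c : Fin (m + 3) → V, IsNumbering C c :=
  ⟨fun ⟨φ⟩ => ⟨_, isNumbering_of_iso φ⟩, fun ⟨_, h⟩ => ⟨h.exists_iso.choose⟩⟩

namespace IsNumbering

variable {m : ℕ} {C : G.Subgraph} {c : Fin (m + 3) → V}

lemma adj_succ (h : IsNumbering C c) (i : Fin (m + 3)) : C.Adj (c i) (c (i + 1)) :=
  (h.adj _ _).2 ⟨i, .inl ⟨rfl, rfl⟩⟩

lemma mem (h : IsNumbering C c) (i : Fin (m + 3)) : c i ∈ C.verts := h.verts ▸ ⟨i, rfl⟩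

lemma rotate (h : IsNumbering C c) (j : Fin (m + 3)) : IsNumbering C (fun i => c (i + j)) where
  inj := h.inj.comp (add_left_injective j)
  verts := by
    rw [h.verts]
    exact ((Equiv.addRight j).surjective.range_comp c).symm
  adj a b := by
    rw [h.adj]
    constructor
    · rintro ⟨i, hi⟩
      exact ⟨i - j, by simpa [sub_add_eq_add_sub, add_right_comm] using hi⟩
    · rintro ⟨i, hi⟩
      exact ⟨i + j, by simpa [add_right_comm] using hi⟩

lemma ncard_verts (h : IsNumbering C c) : C.verts.ncard = m + 3 := by
  rw [h.verts, ← Set.image_univ, Set.ncard_image_of_injective _ h.inj, Set.ncard_univ]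
  simp

lemma finite_verts (h : IsNumbering C c) : C.verts.Finite := by
  rw [h.verts]; exact Set.finite_range c

lemma neighborSet_eq (h : IsNumbering C c) (i : Fin (m + 3)) :
    C.neighborSet (c i) = {c (i - 1), c (i + 1)} := by
  ext b
  simp only [Subgraph.mem_neighborSet, h.adj, Set.mem_insert_iff, Set.mem_singleton_iff]
  constructor
  · rintro ⟨j, ⟨h1, rfl⟩ | ⟨h1, rfl⟩⟩
    · rw [h.inj h1]; exact .inr rfl
    · rw [← h.inj h1]; simp
  · rintro (rfl | rfl)
    · exact ⟨i - 1, .inr (by simp)⟩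
    · exact ⟨i, .inl (by simp)⟩

lemma ncard_neighborSet (h : IsNumbering C c) {v : V} (hv : v ∈ C.verts) :
    (C.neighborSet v).ncard = 2 := by
  rw [h.verts] at hv
  obtain ⟨i, rfl⟩ := hv
  rw [h.neighborSet_eq, Set.ncard_pair]
  intro h'
  have := h.inj h'
  rw [sub_eq_iff_eq_add, add_assoc, left_eq_add] at this
  exact ne_of_beq_false rfl this

lemma reachAvoid (h : IsNumbering C c) (w : V) (t : ℕ)
    (ht : ∀ s : ℕ, s ≤ t → c s ≠ w) : ReachAvoid C w (c 0) (c t) := by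
  induction t with
  | zero => simpa using ReachAvoid.refl C w _
  | succ t ih =>
    refine (ih fun s hs => ht s (by omega)).trans (.of_adj ?_ (ht t (by omega)) (ht _ le_rfl))
    simpa using h.adj_succ t

lemma isTwoConnected (h : IsNumbering C c) : IsTwoConnected C.coe := by
  rw [isTwoConnected_coe_iff]
  constructor
  · rw [← h.finite_verts.cast_ncard_eq, h.ncard_verts]
    exact_mod_cast (by omega : 3 ≤ m + 3)
  · intro w
    -- Rotate so that the deleted vertex, if it is on `C`, gets the last number; the other vertices
    -- then form a path starting at `d 0`.
    have key : ∃ d : Fin (m + 3) → V, IsNumbering C d ∧ ∀ i, i ≠ Fin.last _ → d i ≠ w := by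
      by_cases hw : w ∈ C.verts
      · rw [h.verts] at hw
        obtain ⟨i, rfl⟩ := hw
        refine ⟨_, h.rotate (i + 1), fun j hj hji => hj ?_⟩
        have := h.inj hji
        rw [← add_assoc, add_right_comm, add_eq_right] at this
        rw [← Fin.last_add_one, add_left_inj] at this
        exact this
      · exact ⟨c, h, fun i _ hi => hw (hi ▸ h.mem i)⟩
    obtain ⟨d, hd, hdw⟩ := key
    have hreach : ∀ x ∈ C.verts, x ≠ w → ReachAvoid C w (d 0) x := by
      intro x hx hxw
      rw [hd.verts] at hx
      obtain ⟨i, rfl⟩ := hx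
      have := hd.reachAvoid w i.val ?_
      · simpa using this
      · intro s hs
        by_cases hsi : s = i.val
        · simpa [hsi] using hxw
        · apply hdw
          intro hl
          have hv := congrArg Fin.val hl
          rw [Fin.val_natCast, Nat.mod_eq_of_lt (by omega), Fin.val_last] at hv
          omega
    exact fun x y hx hy hxw hyw => (hreach x hx hxw).symm.trans (hreach y hy hyw)

end IsNumbering

section Polygon

variable {k l : ℕ} {B C D : G.Subgraph}

lemma IsPolygon.exists_isNumbering (hk : 3 ≤ k) (h : IsPolygon G k C) :
    ∃ m, k = m + 3 ∧ ∃ c : Fin (m + 3) → V, IsNumbering C c := by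
  obtain ⟨m, rfl⟩ := Nat.exists_eq_add_of_le' hk
  exact ⟨m, rfl, isPolygon_iff_exists_isNumbering.1 h⟩

lemma IsPolygon.isTwoConnected (hk : 3 ≤ k) (h : IsPolygon G k C) : IsTwoConnected C.coe := by
  obtain ⟨m, rfl, c, hc⟩ := h.exists_isNumbering hk
  exact hc.isTwoConnected

lemma IsPolygon.ncard_verts (hk : 3 ≤ k) (h : IsPolygon G k C) : C.verts.ncard = k := by
  obtain ⟨m, rfl, c, hc⟩ := h.exists_isNumbering hk
  exact hc.ncard_verts

lemma IsPolygon.ncard_neighborSet (hk : 3 ≤ k) (h : IsPolygon G k C) {v : V}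
    (hv : v ∈ C.verts) : (C.neighborSet v).ncard = 2 := by
  obtain ⟨m, rfl, c, hc⟩ := h.exists_isNumbering hk
  exact hc.ncard_neighborSet hv

lemma IsPolygon.reachable (hk : 3 ≤ k) (h : IsPolygon G k C) {x y : V} (hx : x ∈ C.verts)
    (hy : y ∈ C.verts) : C.spanningCoe.Reachable x y := by
  have h2 := isTwoConnected_coe_iff.1 (h.isTwoConnected hk)
  obtain ⟨w, -, hwx, hwy⟩ := exists_ne_ne_of_three_le_encard h2.1 x y
  exact Reachable.mono (deleteIncidenceSet_le _ _) (h2.2 w x y hx hy hwx.symm hwy.symm)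

/-- Polygons are not properly nested. -/
lemma IsPolygon.eq_of_le (hk : 3 ≤ k) (hl : 3 ≤ l) (hC : IsPolygon G k C) (hD : IsPolygon G l D)
    (h : C ≤ D) : C = D := by
  -- Both polygons are 2-regular, so `D` adds no neighbour at a vertex of `C`; connectedness of `D`
  -- does the rest.
  have hnb : ∀ v ∈ C.verts, ∀ b, D.Adj v b → C.Adj v b := by
    intro v hv b hb
    have hfin : (D.neighborSet v).Finite :=
      Set.finite_of_ncard_ne_zero (by rw [hD.ncard_neighborSet hl (h.1 hv)]; norm_num)
    have heq : C.neighborSet v = D.neighborSet v :=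
      Set.eq_of_subset_of_ncard_le (fun b hb => h.2 hb)
        (by rw [hD.ncard_neighborSet hl (h.1 hv), hC.ncard_neighborSet hk hv]) hfin
    exact (Set.ext_iff.1 heq b).2 hb
  obtain ⟨v, hv⟩ : C.verts.Nonempty :=
    Set.nonempty_of_ncard_ne_zero (by rw [hC.ncard_verts hk]; omega)
  have hverts : D.verts ⊆ C.verts := fun x hx =>
    mem_of_reachable (fun a b hab ha => (hnb a ha b hab).snd_mem) (hD.reachable hl (h.1 hv) hx) hv
  exact le_antisymm h ⟨hverts, fun a b hab => hnb a (hverts hab.fst_mem) b hab⟩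

end Polygon

end Cactus

/-! ### Polygons as blocks, and cut vertices -/

namespace Cactus

open SimpleGraph

variable {V : Type*} {G : SimpleGraph V} {k : ℕ}

namespace IsPolygonalCactus

variable [Finite V]

lemma exists_polygon_ge (hG : IsPolygonalCactus G k) {B : G.Subgraph}
    (hB : IsTwoConnected B.coe) : ∃ C, IsPolygon G k C ∧ B ≤ C ∧
      Maximal (fun C : G.Subgraph => IsTwoConnected C.coe) C := by
  obtain ⟨C, hBC, hC⟩ := (Set.toFinite {B : G.Subgraph | IsTwoConnected B.coe}).exists_le_maximal hB
  exact ⟨C, hG.2 C (.inr hC), hBC, hC⟩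

lemma maximal (hG : IsPolygonalCactus G k) (hk : 3 ≤ k) {C : G.Subgraph}
    (hC : IsPolygon G k C) : Maximal (fun C : G.Subgraph => IsTwoConnected C.coe) C := by
  obtain ⟨D, hD, hCD, hmax⟩ := hG.exists_polygon_ge (hC.isTwoConnected hk)
  rwa [hC.eq_of_le hk hk hD hCD]

/-- The union of the two polygons is 2-connected, and each of them is maximal. -/
lemma polygon_unique (hG : IsPolygonalCactus G k) (hk : 3 ≤ k) {C D : G.Subgraph}
    (hC : IsPolygon G k C) (hD : IsPolygon G k D) {a b : V} (hab : a ≠ b) (haC : a ∈ C.verts)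
    (hbC : b ∈ C.verts) (haD : a ∈ D.verts) (hbD : b ∈ D.verts) : C = D := by
  have h := (hC.isTwoConnected hk).sup (hD.isTwoConnected hk) hab haC haD hbC hbD
  rw [(hG.maximal hk hC).eq_of_le h le_sup_left]
  exact ((hG.maximal hk hD).eq_of_le h le_sup_right).symm

/-- A bridge would be a block with two vertices, hence not a polygon. -/
lemma exists_polygon_adj (hG : IsPolygonalCactus G k) (hk : 3 ≤ k) {u v : V} (huv : G.Adj u v) :
    ∃ C, IsPolygon G k C ∧ C.Adj u v := by
  have hb : ¬ G.IsBridge s(u, v) := by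
    intro hb
    have h := (hG.2 _ (.inl ⟨u, v, huv, hb, rfl⟩)).ncard_verts hk
    rw [subgraphOfAdj_verts, Set.ncard_pair huv.ne] at h
    omega
  obtain ⟨B, hB, hBuv⟩ := exists_isTwoConnected_of_not_isBridge huv hb
  obtain ⟨C, hC, hBC, -⟩ := hG.exists_polygon_ge hB
  exact ⟨C, hC, hBC.2 hBuv⟩

lemma isCutVertex_of_ne (hG : IsPolygonalCactus G k) (hk : 3 ≤ k) {C D : G.Subgraph}
    (hC : IsPolygon G k C) (hD : IsPolygon G k D) (hCD : C ≠ D) {v : V} (hvC : v ∈ C.verts)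
    (hvD : v ∈ D.verts) : IsCutVertex G v := by
  by_contra hcut
  rw [not_isCutVertex_iff] at hcut
  have hC2 := hC.isTwoConnected hk
  have hD2 := hD.isTwoConnected hk
  obtain ⟨a, haC, hav, -⟩ := exists_ne_ne_of_three_le_encard (isTwoConnected_coe_iff.1 hC2).1 v v
  obtain ⟨b, hbD, hbv, -⟩ := exists_ne_ne_of_three_le_encard (isTwoConnected_coe_iff.1 hD2).1 v v
  obtain ⟨E, hE, hCE, hDE⟩ := exists_isTwoConnected_of_reachable hC2 hD2 hvC hvD haC hbD hav hbv
    (hcut a b hav hbv)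
  exact hCD (((hG.maximal hk hC).eq_of_le hE hCE).trans ((hG.maximal hk hD).eq_of_le hE hDE).symm)

/-- A walk that passes through `v` leaves it along an edge of `C`, and `C` stays connected without
`v`. -/
lemma not_isCutVertex_of_unique (hG : IsPolygonalCactus G k) (hk : 3 ≤ k) {C : G.Subgraph}
    (hC : IsPolygon G k C) {v : V} (hvC : v ∈ C.verts)
    (h : ∀ D, IsPolygon G k D → v ∈ D.verts → D = C) : ¬ IsCutVertex G v := by
  rw [not_isCutVertex_iff]
  have hC2 := isTwoConnected_coe_iff.1 (hC.isTwoConnected hk)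
  obtain ⟨a, haC, hav, -⟩ := exists_ne_ne_of_three_le_encard hC2.1 v v
  have hCG : ∀ x y, ReachAvoid C v x y → (G.deleteIncidenceSet v).Reachable x y :=
    fun x y hxy => Reachable.mono (fun p q hpq => by
      rw [deleteIncidenceSet_adj] at hpq ⊢
      exact ⟨hpq.1.adj_sub, hpq.2⟩) hxy
  have key : ∀ x, x ≠ v → (G.deleteIncidenceSet v).Reachable a x := by
    intro x hx
    have := mem_of_reachable (S := {x | x ≠ v → (G.deleteIncidenceSet v).Reachable a x}) ?_
      (hG.1.preconnected a x) (fun _ => .refl _)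
    · exact this hx
    · intro p q hpq hp hqv
      by_cases hpv : p = v
      · subst hpv
        obtain ⟨D, hD, hDpq⟩ := hG.exists_polygon_adj hk hpq
        have hDC := h D hD hDpq.fst_mem
        subst hDC
        exact hCG _ _ (hC2.2 p a q haC hDpq.snd_mem hav hqv)
      · exact (hp hpv).trans (Adj.reachable (deleteIncidenceSet_adj.2 ⟨hpq, hpv, hqv⟩))
  exact fun x y hx hy => (key x hx).symm.trans (key y hy)

end IsPolygonalCactus

end Cactus

/-! ### Degrees and the number of vertices -/

namespace Cactus

open SimpleGraph
open scoped Finset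

variable {V : Type*} {G : SimpleGraph V} {k : ℕ}

/-- The finset of `k`-polygons of `G`. -/
noncomputable def polygons (G : SimpleGraph V) (k : ℕ) [Finite V] : Finset G.Subgraph :=
  (Set.toFinite {C : G.Subgraph | IsPolygon G k C}).toFinset

open Classical in
/-- The finset of `k`-polygons of `G` through `v`. -/
noncomputable def polygonsAt (G : SimpleGraph V) (k : ℕ) [Finite V] (v : V) :
    Finset G.Subgraph :=
  (polygons G k).filter (v ∈ ·.verts)

@[simp]
lemma mem_polygons [Finite V] {C : G.Subgraph} : C ∈ polygons G k ↔ IsPolygon G k C := by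
  simp [polygons]

@[simp]
lemma mem_polygonsAt [Finite V] {C : G.Subgraph} {v : V} :
    C ∈ polygonsAt G k v ↔ IsPolygon G k C ∧ v ∈ C.verts := by
  simp [polygonsAt]

lemma InClass.card_polygons [Finite V] {n : ℕ} (h : InClass G n k) : #(polygons G k) = n := by
  rw [← h.2, polygons, Set.ncard_eq_toFinset_card]

variable [Fintype V]

lemma sum_card_polygonsAt (hk : 3 ≤ k) :
    ∑ v, #(polygonsAt G k v) = #(polygons G k) * k := by
  classical
  have h : ∀ C ∈ polygons G k, #{v : V | v ∈ C.verts} = k := fun C hC => by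
    rw [← (mem_polygons.1 hC).ncard_verts hk, Set.ncard_eq_toFinset_card', Set.toFinset_card,
      Fintype.card_subtype]
  rw [← smul_eq_mul, ← Finset.sum_const, ← Finset.sum_congr rfl h]
  simp only [polygonsAt, Finset.card_filter]
  rw [Finset.sum_comm]

namespace IsPolygonalCactus

/-- The polygons through `v` partition its neighbours into pairs. -/
lemma degree_eq (hG : IsPolygonalCactus G k) (hk : 3 ≤ k) [DecidableRel G.Adj] (v : V) :
    G.degree v = 2 * #(polygonsAt G k v) := by
  classical
  have h : G.neighborFinset v = (polygonsAt G k v).biUnion fun C => (C.neighborSet v).toFinset := by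
    ext w
    simp only [mem_neighborFinset, Finset.mem_biUnion, mem_polygonsAt, Set.mem_toFinset,
      Subgraph.mem_neighborSet]
    constructor
    · intro h
      obtain ⟨C, hC, hvw⟩ := hG.exists_polygon_adj hk h
      exact ⟨C, ⟨hC, hvw.fst_mem⟩, hvw⟩
    · rintro ⟨C, -, hvw⟩
      exact hvw.adj_sub
  rw [← card_neighborFinset_eq_degree, h, Finset.card_biUnion, Finset.sum_const_nat, mul_comm]
  · intro C hC
    rw [mem_polygonsAt] at hC
    rw [← Set.ncard_eq_toFinset_card', hC.1.ncard_neighborSet hk hC.2]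
  · intro C hC D hD hCD
    rw [Finset.mem_coe, mem_polygonsAt] at hC hD
    rw [Function.onFun, Finset.disjoint_left]
    intro w hw hw'
    simp only [Set.mem_toFinset, Subgraph.mem_neighborSet] at hw hw'
    exact hCD (hG.polygon_unique hk hC.1 hD.1 hw.ne hw.fst_mem hw.snd_mem hw'.fst_mem hw'.snd_mem)

lemma card_polygonsAt_pos [Nontrivial V] (hG : IsPolygonalCactus G k) (hk : 3 ≤ k) (v : V) :
    0 < #(polygonsAt G k v) := by
  classical
  obtain ⟨w, hw⟩ := hG.1.preconnected.exists_adj_of_nontrivial v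
  obtain ⟨C, hC, hvw⟩ := hG.exists_polygon_adj hk hw
  exact Finset.card_pos.2 ⟨C, mem_polygonsAt.2 ⟨hC, hvw.fst_mem⟩⟩

lemma isCutVertex_iff [Nontrivial V] (hG : IsPolygonalCactus G k) (hk : 3 ≤ k) {v : V} :
    IsCutVertex G v ↔ 2 ≤ #(polygonsAt G k v) := by
  constructor
  · intro hv
    by_contra h
    have hpos := hG.card_polygonsAt_pos hk v
    obtain ⟨C, hC⟩ := Finset.card_eq_one.1 (by omega : #(polygonsAt G k v) = 1)
    have hC' : ∀ D, IsPolygon G k D ∧ v ∈ D.verts ↔ D = C := fun D => by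
      rw [← mem_polygonsAt, hC, Finset.mem_singleton]
    have := (hC' C).2 rfl
    exact hG.not_isCutVertex_of_unique hk this.1 this.2 (fun D hD hv => (hC' D).1 ⟨hD, hv⟩) hv
  · intro h
    obtain ⟨C, hC, D, hD, hCD⟩ := Finset.one_lt_card.1 h
    rw [mem_polygonsAt] at hC hD
    exact hG.isCutVertex_of_ne hk hC.1 hD.1 hCD hC.2 hD.2

/-- Removing one edge from each polygon leaves a spanning tree. -/
lemma card_add_card_polygons (hG : IsPolygonalCactus G k) (hk : 3 ≤ k) :
    Fintype.card V + #(polygons G k) = #(polygons G k) * k + 1 := by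
  classical
  have hex : ∀ C : polygons G k, ∃ e ∈ G.edgeSet, e ∈ C.1.edgeSet := by
    rintro ⟨C, hC⟩
    obtain ⟨m, rfl, c, hc⟩ := (mem_polygons.1 hC).exists_isNumbering hk
    exact ⟨s(c 0, c (0 + 1)), (hc.adj_succ 0).adj_sub, hc.adj_succ 0⟩
  choose e heG heC using hex
  have huniq : ∀ {a b : V} {C D : G.Subgraph}, IsPolygon G k C → IsPolygon G k D →
      C.Adj a b → D.Adj a b → C = D := fun hC hD hab hab' =>
    hG.polygon_unique hk hC hD hab.ne hab.fst_mem hab.snd_mem hab'.fst_mem hab'.snd_mem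
  have hinj : Function.Injective e := by
    intro C D hCD
    have h1 := heC C
    have h2 := heC D
    rw [hCD] at h1
    induction he : e D with
    | h a b =>
      rw [he] at h1 h2
      exact Subtype.ext (huniq (mem_polygons.1 C.2) (mem_polygons.1 D.2) h1 h2)
  set S : Finset (Sym2 V) := Finset.univ.image e with hS
  have hScard : #S = #(polygons G k) := by
    rw [hS, Finset.card_image_of_injective _ hinj, Finset.card_univ, Fintype.card_coe]
  have hSG : S ⊆ G.edgeFinset := by
    intro x hx
    obtain ⟨C, -, rfl⟩ := Finset.mem_image.1 hx
    exact mem_edgeFinset.2 (heG C)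
  have hmemS : ∀ {a b : V} {C : G.Subgraph} (hC : C ∈ polygons G k), C.Adj a b →
      s(a, b) ∈ S → e ⟨C, hC⟩ = s(a, b) := by
    intro a b C hC hab hs
    obtain ⟨D, -, hD⟩ := Finset.mem_image.1 hs
    have hDab := heC D
    rw [hD] at hDab
    have := huniq (mem_polygons.1 hC) (mem_polygons.1 D.2) hab hDab
    subst this
    exact hD
  set T := G.deleteEdges (S : Set (Sym2 V)) with hT
  have hTadj : ∀ a b, T.Adj a b ↔ G.Adj a b ∧ s(a, b) ∉ S := by
    intro a b; simp [hT, deleteEdges_adj]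
  have hconn : T.Connected := by
    have := hG.1.nonempty
    refine (connected_iff _).2 ⟨fun x y => ?_, this⟩
    refine mem_of_reachable (S := {y | T.Reachable x y}) ?_ (hG.1.preconnected x y) (.refl _)
    intro a b hab hxa
    refine Reachable.trans hxa ?_
    obtain ⟨C, hC, hCab⟩ := hG.exists_polygon_adj hk hab
    by_cases hs : s(a, b) ∈ S
    · have he := hmemS (mem_polygons.2 hC) hCab hs
      refine ((hC.isTwoConnected hk).reachable_deleteEdges hCab).mono ?_
      intro p q hpq
      rw [deleteEdges_adj] at hpq
      rw [hTadj]
      refine ⟨hpq.1.adj_sub, fun hs' => hpq.2 ?_⟩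
      rw [Set.mem_singleton_iff, ← hmemS (mem_polygons.2 hC) hpq.1 hs', he]
    · exact Adj.reachable ((hTadj a b).2 ⟨hab, hs⟩)
  -- A cycle of `T` is 2-connected, so it lies in some `k`-polygon `D` and equals it; but `D` has
  -- lost an edge.
  have hacyc : T.IsAcyclic := by
    rw [isAcyclic_iff_free_cycleGraph]
    rintro l hl ⟨f⟩
    let g := (Copy.ofLE T G (deleteEdges_le _)).comp f
    have hC : IsPolygon G l g.toSubgraph := ⟨g.isoToSubgraph⟩
    have hCT : ∀ a b, g.toSubgraph.Adj a b → T.Adj a b := by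
      rintro a b ⟨i, j, hij, rfl, rfl⟩
      exact f.toHom.map_adj (by simpa using hij)
    obtain ⟨D, hD, hCD, -⟩ := hG.exists_polygon_ge (hC.isTwoConnected hl)
    have hDS := heC ⟨D, mem_polygons.2 hD⟩
    have heS : e ⟨D, mem_polygons.2 hD⟩ ∈ S := Finset.mem_image_of_mem _ (Finset.mem_univ _)
    have hDC : ∀ x ∈ D.edgeSet, x ∈ g.toSubgraph.edgeSet := by
      rw [hC.eq_of_le hl hk hD hCD]
      exact fun _ => id
    replace hDS := hDC _ hDS
    induction he : e ⟨D, mem_polygons.2 hD⟩ with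
    | h a b =>
      rw [he] at hDS heS
      exact ((hTadj a b).1 (hCT a b hDS)).2 heS
  have hcard := (IsTree.mk hconn hacyc).card_edgeFinset
  have hTE : T.edgeFinset = G.edgeFinset \ S := by
    ext x
    induction x with
    | h a b => simp [hTadj]
  rw [hTE, Finset.card_sdiff_of_subset hSG, hScard] at hcard
  have hE : #G.edgeFinset = #(polygons G k) * k := by
    have h1 := G.sum_degrees_eq_twice_card_edges
    simp_rw [hG.degree_eq hk] at h1
    rw [← Finset.mul_sum, sum_card_polygonsAt hk] at h1
    omega
  have hle := Finset.card_le_card hSG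
  omega

end IsPolygonalCactus

end Cactus

/-! ### Inequalities for the weight of an edge -/

namespace Cactus

/-- The `α`-norm of the pair `(x, y)`. -/
noncomputable def pairNorm (α x y : ℝ) : ℝ := (x ^ α + y ^ α) ^ (1 / α)

lemma pairNorm_comm (α x y : ℝ) : pairNorm α x y = pairNorm α y x := by
  rw [pairNorm, add_comm, pairNorm]

lemma pairNorm_add_le {α a b c d : ℝ} (hα : 1 ≤ α) (ha : 0 ≤ a) (hb : 0 ≤ b) (hc : 0 ≤ c)
    (hd : 0 ≤ d) : pairNorm α (a + c) (b + d) ≤ pairNorm α a b + pairNorm α c d := by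
  have := Real.Lp_add_le_of_nonneg (s := Finset.univ) (f := ![a, b]) (g := ![c, d]) hα
    (by simp [Fin.forall_fin_two, ha, hb]) (by simp [Fin.forall_fin_two, hc, hd])
  simpa [Fin.sum_univ_two, pairNorm] using this

lemma pairNorm_smul {α t x y : ℝ} (hα : 1 ≤ α) (ht : 0 ≤ t) (hx : 0 ≤ x) (hy : 0 ≤ y) :
    pairNorm α (t * x) (t * y) = t * pairNorm α x y := by
  have h0 : α ≠ 0 := by linarith
  rw [pairNorm, pairNorm, Real.mul_rpow ht hx, Real.mul_rpow ht hy, ← mul_add,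
    Real.mul_rpow (by positivity) (by positivity), ← Real.rpow_mul ht, mul_one_div_cancel h0,
    Real.rpow_one]

lemma pairNorm_self {α x : ℝ} (hα : 1 ≤ α) (hx : 0 ≤ x) :
    pairNorm α x x = (2 : ℝ) ^ (1 / α) * x := by
  have := pairNorm_smul hα hx zero_le_one zero_le_one
  rw [mul_one] at this
  rw [this, pairNorm, Real.one_rpow, one_add_one_eq_two, mul_comm]

/-- Triangle inequality for `(x, y) + (y, x)`. -/
lemma le_pairNorm {α x y : ℝ} (hα : 1 ≤ α) (hx : 0 ≤ x) (hy : 0 ≤ y) :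
    (2 : ℝ) ^ (1 / α) / 2 * (x + y) ≤ pairNorm α x y := by
  have h := pairNorm_add_le hα hx hy hy hx
  rw [add_comm y x, pairNorm_self hα (by positivity), pairNorm_comm α y x] at h
  linarith

/-- The excess of `pairNorm` over its linear lower bound, at `(2, 4)`. -/
noncomputable def excess (α : ℝ) : ℝ := pairNorm α 2 4 - 3 * (2 : ℝ) ^ (1 / α)

/-- Strict convexity of `t ^ α` at 3, the midpoint of 2 and 4. -/
lemma excess_pos {α : ℝ} (hα : 1 < α) : 0 < excess α := by
  have h := (strictConvexOn_rpow hα).2 (Set.mem_Ici.2 (by norm_num : (0 : ℝ) ≤ 2))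
    (Set.mem_Ici.2 (by norm_num : (0 : ℝ) ≤ 4)) (by norm_num)
    (by norm_num : (0 : ℝ) < 1 / 2) (by norm_num : (0 : ℝ) < 1 / 2) (by norm_num)
  norm_num at h
  have h3 : (3 : ℝ) ^ α + 3 ^ α < 2 ^ α + 4 ^ α := by linarith
  have h4 : pairNorm α 3 3 < pairNorm α 2 4 :=
    Real.rpow_lt_rpow (by positivity) h3 (by positivity)
  rw [pairNorm_self hα.le (by norm_num)] at h4
  rw [excess]
  linarith

/-- Triangle inequality for `(q - 2) • (2, 4) = (q - 4) • (2, 2) + 2 • (2, q)`. It even yields `(q -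
2) / 2` times the excess, a factor of at least 1. -/
lemma excess_le_pairNorm {α q : ℝ} (hα : 1 < α) (hq : 4 ≤ q) :
    (2 : ℝ) ^ (1 / α) / 2 * (2 + q) + excess α ≤ pairNorm α 2 q := by
  have h := pairNorm_add_le hα.le (a := (q - 4) * 2) (b := (q - 4) * 2) (c := 2 * 2) (d := 2 * q)
    (by linarith) (by linarith) (by norm_num) (by linarith)
  rw [pairNorm_smul hα.le (by linarith) (by norm_num) (by norm_num),
    pairNorm_smul hα.le (by norm_num) (by norm_num) (by linarith),
    show (q - 4) * 2 + 2 * 2 = (q - 2) * 2 by ring,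
    show (q - 4) * 2 + 2 * q = (q - 2) * 4 + (0 : ℝ) by ring, add_zero,
    pairNorm_smul hα.le (by linarith) (by norm_num) (by norm_num),
    pairNorm_self hα.le (by norm_num)] at h
  have hpos := excess_pos hα
  have : pairNorm α 2 4 = excess α + 3 * (2 : ℝ) ^ (1 / α) := by rw [excess]; ring
  rw [this] at h
  nlinarith

end Cactus

/-! ### Changes around a cycle, and mixed edges -/

namespace Cactus

open SimpleGraph
open scoped Finset Fin.NatCast

section Cyclic

variable {m : ℕ}

open Classical in
/-- The number of changes of `χ` around the cycle `0, …, m + 2`. -/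
noncomputable def numChanges (χ : Fin (m + 3) → Prop) : ℕ :=
  #{i | ¬ (χ i ↔ χ (i + 1))}

lemma numChanges_rotate (χ : Fin (m + 3) → Prop) (r : Fin (m + 3)) :
    numChanges (fun i => χ (i + r)) = numChanges χ := by
  classical
  unfold numChanges
  refine Finset.card_equiv (Equiv.addRight r) fun i => ?_
  simp [add_right_comm]

/-- Going backwards from a true position, some step must reach a false one; `Fin.last _ + r` is `r -
1`. -/
lemma exists_change (χ : Fin (m + 3) → Prop) (h1 : ∃ i, χ i) (h0 : ∃ i, ¬ χ i) :
    ∃ r, χ (0 + r) ∧ ¬ χ (Fin.last _ + r) := by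
  by_contra! hcon
  obtain ⟨i, hi⟩ := h1
  obtain ⟨j, hj⟩ := h0
  have key : ∀ s : ℕ, χ (i - s) := by
    intro s
    induction s with
    | zero => simpa using hi
    | succ s ih =>
      have := hcon (i - s) (by simpa using ih)
      have h2 : Fin.last (m + 2) = -1 := by
        rw [eq_neg_iff_add_eq_zero, Fin.last_add_one]
      rw [h2] at this
      convert this using 1
      rw [Nat.cast_succ, sub_add_eq_sub_sub, sub_eq_add_neg (i - _)]
      exact add_comm _ _
  have := key (i - j).val
  simp [hj] at this

lemma val_add_one_of_ne_last {i : Fin (m + 3)} (h : i ≠ Fin.last _) :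
    (i + 1).val = i.val + 1 := Fin.val_add_one_of_lt (Fin.lt_last_iff_ne_last.2 h)

/-- With `l` the first false position, changes occur at `l - 1` and at the last position. If there
are no others, `χ` stays false from `l` on. -/
lemma changes_of_normalized (χ : Fin (m + 3) → Prop) (h1 : χ 0) (h0 : ¬ χ (Fin.last _)) :
    2 ≤ numChanges χ ∧ (numChanges χ ≤ 2 → ∃ l : ℕ, ∀ i, χ i ↔ i.val < l) := by
  classical
  have hex : ∃ t : ℕ, ∃ h : t < m + 3, ¬ χ ⟨t, h⟩ := ⟨m + 2, by omega, h0⟩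
  obtain ⟨hl, hχl⟩ := Nat.find_spec hex
  have hmin : ∀ t (h : t < m + 3), t < Nat.find hex → χ ⟨t, h⟩ := fun t h ht => by
    have := Nat.find_min hex ht
    push Not at this
    exact this h
  set l := Nat.find hex
  have hl0 : l ≠ 0 := by
    intro h
    have : (⟨l, hl⟩ : Fin (m + 3)) = 0 := Fin.ext h
    exact hχl (this ▸ h1)
  let p : Fin (m + 3) := ⟨l - 1, by omega⟩
  have hp1 : p + 1 = ⟨l, hl⟩ := by
    apply Fin.ext
    rw [val_add_one_of_ne_last]
    · simp only [p]; omega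
    · intro h
      have := congrArg Fin.val h
      simp only [p, Fin.val_last] at this
      omega
  have hplast : p ≠ Fin.last _ := by
    intro h
    have := congrArg Fin.val h
    simp only [p, Fin.val_last] at this
    omega
  have hsub : ({p, Fin.last _} : Finset (Fin (m + 3))) ⊆
      Finset.univ.filter fun i => ¬ (χ i ↔ χ (i + 1)) := by
    intro i hi
    rw [Finset.mem_insert, Finset.mem_singleton] at hi
    rw [Finset.mem_filter]
    refine ⟨Finset.mem_univ _, ?_⟩
    rcases hi with rfl | rfl
    · rw [hp1]
      have := hmin (l - 1) (by omega) (by omega)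
      tauto
    · rw [Fin.last_add_one]
      tauto
  have hcard : #({p, Fin.last _} : Finset (Fin (m + 3))) = 2 := Finset.card_pair hplast
  refine ⟨hcard ▸ Finset.card_le_card hsub, fun hle => ⟨l, ?_⟩⟩
  have heq := Finset.eq_of_subset_of_card_le hsub (by rw [hcard]; exact hle)
  have hstep : ∀ t, l ≤ t → ∀ h : t < m + 3, ¬ χ ⟨t, h⟩ := by
    intro t ht
    induction t, ht using Nat.le_induction with
    | base => exact fun _ => hχl
    | succ t ht ih =>
      intro h
      have hne : (⟨t, by omega⟩ : Fin (m + 3)) ≠ Fin.last _ := by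
        intro h'
        have := congrArg Fin.val h'
        simp only [Fin.val_last] at this
        omega
      have hnp : (⟨t, by omega⟩ : Fin (m + 3)) ≠ p := by
        intro h'
        have := congrArg Fin.val h'
        simp only [p] at this
        omega
      have hnot : (⟨t, by omega⟩ : Fin (m + 3)) ∉
          Finset.univ.filter fun i => ¬ (χ i ↔ χ (i + 1)) := by
        rw [← heq]
        simp [hne, hnp]
      rw [Finset.mem_filter] at hnot
      have hsucc : (⟨t, by omega⟩ : Fin (m + 3)) + 1 = ⟨t + 1, h⟩ :=
        Fin.ext (val_add_one_of_ne_last hne)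
      rw [hsucc] at hnot
      have := ih (by omega)
      simp only [Finset.mem_univ, true_and, not_not] at hnot
      rwa [← hnot]
  intro i
  constructor
  · intro hi
    by_contra hil
    exact hstep i.val (by omega) i.2 hi
  · exact fun hi => hmin i.val i.2 hi

lemma two_le_numChanges (χ : Fin (m + 3) → Prop) (h1 : ∃ i, χ i) (h0 : ∃ i, ¬ χ i) :
    2 ≤ numChanges χ := by
  obtain ⟨r, hr1, hr0⟩ := exists_change χ h1 h0
  rw [← numChanges_rotate χ r]
  exact (changes_of_normalized (fun i => χ (i + r)) hr1 hr0).1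

lemma numChanges_le_two_iff (χ : Fin (m + 3) → Prop) :
    numChanges χ ≤ 2 ↔ ∃ (r : Fin (m + 3)) (l : ℕ), ∀ i, χ (i + r) ↔ i.val < l := by
  classical
  constructor
  · intro h
    by_cases h1 : ∃ i, χ i
    · by_cases h0 : ∃ i, ¬ χ i
      · obtain ⟨r, hr1, hr0⟩ := exists_change χ h1 h0
        rw [← numChanges_rotate χ r] at h
        exact ⟨r, (changes_of_normalized (fun i => χ (i + r)) hr1 hr0).2 h⟩
      · push Not at h0
        exact ⟨0, m + 3, fun i => by simp [h0]⟩
    · push Not at h1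
      exact ⟨0, 0, fun i => by simp [h1]⟩
  · rintro ⟨r, l, h⟩
    rw [← numChanges_rotate χ r, numChanges]
    -- Truncation of `l - 1` at `l = 0` and wrap-around of the cast for large `l` are harmless: the
    -- pair only has to contain every change.
    refine (Finset.card_le_card (t := {Fin.last _, ((l - 1 : ℕ) : Fin (m + 3))}) ?_).trans
      Finset.card_le_two
    intro i hi
    rw [Finset.mem_filter, h, h] at hi
    rw [Finset.mem_insert, Finset.mem_singleton]
    by_cases hlast : i = Fin.last _
    · exact .inl hlast
    · right
      rw [val_add_one_of_ne_last hlast] at hi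
      have : i.val = l - 1 := by omega
      rw [← this]
      simp

end Cyclic

variable {V : Type*} {G : SimpleGraph V} {k n : ℕ}

/-- The edge `e` has one end that satisfies `χ` and one that does not. -/
def IsMixed (χ : V → Prop) (e : Sym2 V) : Prop := ∃ u ∈ e, ∃ v ∈ e, χ u ∧ ¬ χ v

lemma isMixed_mk {χ : V → Prop} {a b : V} : IsMixed χ s(a, b) ↔ ¬ (χ a ↔ χ b) := by
  simp only [IsMixed, Sym2.mem_iff, exists_eq_or_imp, exists_eq_left]
  tauto

/-- The number of edges of `C` that join a cut vertex of `G` to another vertex. -/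
noncomputable def numMixed (C : G.Subgraph) : ℕ :=
  {e | e ∈ C.edgeSet ∧ IsMixed (IsCutVertex G) e}.ncard

lemma IsNumbering.numMixed_eq {m : ℕ} {C : G.Subgraph} {c : Fin (m + 3) → V}
    (h : IsNumbering C c) : numMixed C = numChanges fun i => IsCutVertex G (c i) := by
  classical
  have hinj : Function.Injective fun i => s(c i, c (i + 1)) := by
    intro i j hij
    simp only [Sym2.eq_iff, h.inj.eq_iff] at hij
    rcases hij with ⟨hij, -⟩ | ⟨rfl, hij⟩
    · exact hij
    · rw [add_assoc, add_eq_left] at hij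
      exact absurd hij (ne_of_beq_false rfl)
  rw [numMixed, numChanges, ← Set.ncard_coe_finset, ← Set.ncard_image_of_injective _ hinj]
  congr 1
  ext e
  induction e with
  | h a b =>
    simp only [Set.mem_ofPred_eq, Subgraph.mem_edgeSet, h.adj, Finset.coe_filter,
      Finset.mem_univ, true_and, Set.mem_image]
    constructor
    · rintro ⟨⟨i, ⟨rfl, rfl⟩ | ⟨rfl, rfl⟩⟩, hm⟩
      · exact ⟨i, isMixed_mk.1 hm, rfl⟩
      · exact ⟨i, fun h' => isMixed_mk.1 hm h'.symm, Sym2.eq_swap⟩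
    · rintro ⟨i, hi, he⟩
      rw [← he]
      refine ⟨⟨i, ?_⟩, isMixed_mk.2 hi⟩
      have := Sym2.eq_iff.1 he
      tauto

/-- At most two changes around a cycle means that the true positions form an arc, possibly empty or
full. -/
lemma IsPolygon.consecutive_iff (hk : 3 ≤ k) {C : G.Subgraph} (hC : IsPolygon G k C) :
    CutVerticesConsecutive G k C ↔ numMixed C ≤ 2 := by
  obtain ⟨m, rfl, c, hc⟩ := hC.exists_isNumbering hk
  constructor
  · rintro ⟨φ, l, h⟩
    rw [(isNumbering_of_iso φ).numMixed_eq, numChanges_le_two_iff]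
    exact ⟨0, l, fun i => by simpa using h i⟩
  · intro h
    rw [hc.numMixed_eq, numChanges_le_two_iff] at h
    obtain ⟨r, l, h⟩ := h
    obtain ⟨φ, hφ⟩ := (hc.rotate r).exists_iso
    exact ⟨φ, l, fun i => by rw [hφ]; exact h i⟩

lemma IsPolygon.two_le_numMixed (hk : 3 ≤ k) {C : G.Subgraph} (hC : IsPolygon G k C)
    (h1 : ∃ v ∈ C.verts, IsCutVertex G v) (h0 : ¬ IsSaturatedPolygon G k C) :
    2 ≤ numMixed C := by
  obtain ⟨m, rfl, c, hc⟩ := hC.exists_isNumbering hk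
  rw [hc.numMixed_eq]
  have h0' : ∃ v ∈ C.verts, ¬ IsCutVertex G v := by
    by_contra! hcon
    exact h0 ⟨hC, hcon⟩
  apply two_le_numChanges
  · obtain ⟨v, hv, h⟩ := h1
    rw [hc.verts] at hv
    obtain ⟨i, rfl⟩ := hv
    exact ⟨i, h⟩
  · obtain ⟨v, hv, h⟩ := h0'
    rw [hc.verts] at hv
    obtain ⟨i, rfl⟩ := hv
    exact ⟨i, h⟩

lemma IsSaturatedPolygon.numMixed_eq_zero {C : G.Subgraph} (hC : IsSaturatedPolygon G k C) :
    numMixed C = 0 := by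
  rw [numMixed]
  convert Set.ncard_empty (Sym2 V)
  rw [Set.eq_empty_iff_forall_notMem]
  intro e
  induction e with
  | h a b =>
    rintro ⟨he, hm⟩
    have he' : C.Adj a b := he
    rw [isMixed_mk] at hm
    exact hm ⟨fun _ => hC.2 b he'.snd_mem, fun _ => hC.2 a he'.fst_mem⟩

end Cactus

/-! ### Counting saturated polygons and mixed edges -/

namespace Cactus

open SimpleGraph
open scoped Finset

variable {V : Type*} {G : SimpleGraph V} {k n : ℕ}

namespace InClass

variable [Fintype V]

lemma nontrivial (hG : InClass G n k) (hk : 3 ≤ k) (hn : 0 < n) : Nontrivial V := by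
  rw [← hG.card_polygons, Finset.card_pos] at hn
  obtain ⟨C, hC⟩ := hn
  have h := (mem_polygons.1 hC).ncard_verts hk
  obtain ⟨a, -, b, -, hab⟩ := Set.one_lt_ncard_iff_nontrivial.1 (by omega : 1 < C.verts.ncard)
  exact ⟨a, b, hab⟩

lemma card_vertices (hG : InClass G n k) (hk : 3 ≤ k) : Fintype.card V + n = n * k + 1 := by
  have := hG.1.card_add_card_polygons hk
  rwa [hG.card_polygons] at this

/-- Without cut vertices `C` would meet no other polygon, so no edge would leave it; by
connectedness `C` would be the only polygon. -/
lemma exists_isCutVertex (hG : InClass G n k) (hk : 3 ≤ k) (hn : 2 ≤ n) {C : G.Subgraph}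
    (hC : IsPolygon G k C) : ∃ v ∈ C.verts, IsCutVertex G v := by
  by_contra! hcon
  have huniq : ∀ D, IsPolygon G k D → ∀ v ∈ C.verts, v ∈ D.verts → D = C := by
    intro D hD v hv hvD
    by_contra hne
    exact hcon v hv (hG.1.isCutVertex_of_ne hk hC hD (Ne.symm hne) hv hvD)
  have hne : ∀ D, IsPolygon G k D → D.verts.Nonempty := fun D hD =>
    Set.nonempty_of_ncard_ne_zero (by rw [hD.ncard_verts hk]; omega)
  obtain ⟨v, hv⟩ := hne C hC
  have hall : ∀ x, x ∈ C.verts := fun x =>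
    mem_of_reachable (fun a b hab ha => by
      obtain ⟨D, hD, hDab⟩ := hG.1.exists_polygon_adj hk hab
      rw [← huniq D hD a ha hDab.fst_mem]
      exact hDab.snd_mem) (hG.1.1.preconnected v x) hv
  rw [← hG.card_polygons] at hn
  obtain ⟨D, hD, E, hE, hDE⟩ := Finset.one_lt_card.1 hn
  have hC' : ∀ D ∈ polygons G k, D = C := fun D hD => by
    obtain ⟨x, hx⟩ := hne D (mem_polygons.1 hD)
    exact huniq D (mem_polygons.1 hD) x (hall x) hx
  exact hDE ((hC' D hD).trans (hC' E hE).symm)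

open Classical in
lemma numSaturated_eq : numSaturated G k = #{C ∈ polygons G k | IsSaturatedPolygon G k C} := by
  rw [numSaturated, ← Set.ncard_coe_finset]
  congr 1
  ext C
  simp only [Finset.coe_filter, mem_polygons, Set.mem_ofPred_eq]
  exact ⟨fun h => ⟨h.1, h⟩, fun h => h.2⟩

/-- Count pairs of a polygon and a cut vertex on it. Each polygon contributes at least 1, a
saturated one `k`. From the side of the vertices the count is at most `∑ 2 * (p(v) - 1) = 2 * (nk -
|V|) = 2n - 2`. -/
lemma numSaturated_mul_le (hG : InClass G n k) (hk : 3 ≤ k) (hn : 2 ≤ n) :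
    n + numSaturated G k * (k - 1) + 2 ≤ 2 * n := by
  classical
  have := hG.nontrivial hk (by omega)
  have hlow : ∀ C ∈ polygons G k, 1 + (if IsSaturatedPolygon G k C then k - 1 else 0) ≤
      #{v | v ∈ C.verts ∧ IsCutVertex G v} := by
    intro C hC
    rw [mem_polygons] at hC
    split_ifs with hs
    · have : (Finset.univ.filter fun v => v ∈ C.verts ∧ IsCutVertex G v) = C.verts.toFinset := by
        ext v
        simp only [Finset.mem_filter, Finset.mem_univ, true_and, Set.mem_toFinset]
        exact ⟨fun h => h.1, fun h => ⟨h, hs.2 v h⟩⟩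
      rw [this, ← Set.ncard_eq_toFinset_card', hC.ncard_verts hk]
      omega
    · obtain ⟨v, hv, hcut⟩ := hG.exists_isCutVertex hk hn hC
      exact Finset.card_pos.2 ⟨v, by simp [hv, hcut]⟩
  have h1 := Finset.sum_le_sum hlow
  rw [Finset.sum_add_distrib, Finset.sum_const, hG.card_polygons, ← Finset.sum_filter,
    Finset.sum_const, ← numSaturated_eq, smul_eq_mul, smul_eq_mul, mul_one] at h1
  have hswap : ∑ C ∈ polygons G k, #{v | v ∈ C.verts ∧ IsCutVertex G v} =
      ∑ v, if IsCutVertex G v then #(polygonsAt G k v) else 0 := by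
    simp only [polygonsAt, Finset.card_filter]
    rw [Finset.sum_comm]
    refine Finset.sum_congr rfl fun v _ => ?_
    split_ifs with h <;> simp [h]
  have hup : ∀ v ∈ (Finset.univ : Finset V),
      (if IsCutVertex G v then #(polygonsAt G k v) else 0) + 2 ≤ 2 * #(polygonsAt G k v) := by
    intro v _
    have hpos := hG.1.card_polygonsAt_pos hk v
    split_ifs with hc
    · rw [hG.1.isCutVertex_iff hk] at hc
      omega
    · omega
  have h2 := Finset.sum_le_sum hup
  rw [Finset.sum_add_distrib, ← hswap, Finset.sum_const, Finset.card_univ, ← Finset.mul_sum,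
    sum_card_polygonsAt hk, hG.card_polygons, smul_eq_mul] at h2
  have h3 := hG.card_vertices hk
  omega

/-- The bound holds polygon by polygon. A saturated polygon always gives equality, and its cut
vertices are trivially consecutive. -/
lemma sum_numMixed_ge (hG : InClass G n k) (hk : 3 ≤ k) (hn : 2 ≤ n) :
    2 * n ≤ ∑ C ∈ polygons G k, numMixed C + 2 * numSaturated G k ∧
    (2 * n = ∑ C ∈ polygons G k, numMixed C + 2 * numSaturated G k ↔
      ∀ C, IsPolygon G k C → CutVerticesConsecutive G k C) := by
  classical
  have hle : ∀ C ∈ polygons G k,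
      2 ≤ numMixed C + if IsSaturatedPolygon G k C then 2 else 0 := by
    intro C hC
    rw [mem_polygons] at hC
    split_ifs with hs
    · omega
    · exact hC.two_le_numMixed hk (hG.exists_isCutVertex hk hn hC) hs
  have hsum : ∑ C ∈ polygons G k, (numMixed C + if IsSaturatedPolygon G k C then 2 else 0) =
      ∑ C ∈ polygons G k, numMixed C + 2 * numSaturated G k := by
    rw [Finset.sum_add_distrib, ← Finset.sum_filter, Finset.sum_const, ← numSaturated_eq,
      smul_eq_mul, mul_comm 2]
  have hconst : ∑ C ∈ polygons G k, 2 = 2 * n := by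
    rw [Finset.sum_const, hG.card_polygons, smul_eq_mul, mul_comm]
  rw [← hsum, ← hconst]
  refine ⟨Finset.sum_le_sum hle, ?_⟩
  rw [Finset.sum_eq_sum_iff_of_le hle]
  refine ⟨fun h C hC => ?_, fun h C hC => ?_⟩
  · rw [hC.consecutive_iff hk]
    have := h C (mem_polygons.2 hC)
    omega
  · rw [mem_polygons] at hC
    have h1 := hle C (mem_polygons.2 hC)
    have h2 := (hC.consecutive_iff hk).1 (h C hC)
    split_ifs at h1 ⊢ with hs
    · rw [hs.numMixed_eq_zero]
    · omega

lemma card_mixed_eq (hG : InClass G n k) (hk : 3 ≤ k) [Fintype G.edgeSet]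
    [DecidablePred (IsMixed (IsCutVertex G))] :
    #{e ∈ G.edgeFinset | IsMixed (IsCutVertex G) e} = ∑ C ∈ polygons G k, numMixed C := by
  classical
  have h : {e ∈ G.edgeFinset | IsMixed (IsCutVertex G) e} = (polygons G k).biUnion fun C =>
      {e | e ∈ C.edgeSet ∧ IsMixed (IsCutVertex G) e}.toFinset := by
    ext e
    simp only [Finset.mem_filter, mem_edgeFinset, Finset.mem_biUnion, mem_polygons,
      Set.mem_toFinset, Set.mem_ofPred_eq]
    constructor
    · rintro ⟨he, hm⟩
      induction e with
      | h a b =>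
        obtain ⟨C, hC, hab⟩ := hG.1.exists_polygon_adj hk he
        exact ⟨C, hC, hab, hm⟩
    · rintro ⟨C, hC, he, hm⟩
      exact ⟨C.edgeSet_subset he, hm⟩
  rw [h, Finset.card_biUnion]
  · refine Finset.sum_congr rfl fun C _ => ?_
    rw [numMixed, Set.ncard_eq_toFinset_card']
  · intro C hC D hD hCD
    rw [Finset.mem_coe, mem_polygons] at hC hD
    rw [Function.onFun, Finset.disjoint_left]
    intro e he he'
    simp only [Set.mem_toFinset, Set.mem_ofPred_eq] at he he'
    induction e with
    | h a b =>
      have h1 : C.Adj a b := he.1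
      have h2 : D.Adj a b := he'.1
      exact hCD (hG.1.polygon_unique hk hC hD h1.ne h1.fst_mem h1.snd_mem h2.fst_mem h2.snd_mem)

end InClass

end Cactus

/-! ### Summing the edge weights -/

namespace Cactus

open SimpleGraph
open scoped Finset

variable {V : Type*} {G : SimpleGraph V} {k n : ℕ} [Fintype V]

/-- The sum over the edges of a vertex weight of the two ends. -/
lemma sum_edgeFinset_sum_mem [DecidableEq V] [DecidableRel G.Adj] (d : V → ℝ) :
    ∑ e ∈ G.edgeFinset, ∑ w, (if w ∈ e then d w else 0) = ∑ v, G.degree v * d v := by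
  rw [Finset.sum_comm]
  refine Finset.sum_congr rfl fun v _ => ?_
  rw [← Finset.sum_filter, Finset.sum_const, nsmul_eq_mul, ← incidenceFinset_eq_filter,
    card_incidenceFinset_eq_degree]

lemma sum_ite_mem_mk [DecidableEq V] {a b : V} (hab : a ≠ b) (d : V → ℝ) :
    ∑ w, (if w ∈ s(a, b) then d w else 0) = d a + d b := by
  rw [← Finset.sum_filter, ← Finset.sum_pair hab]
  congr 1
  ext w
  simp

namespace InClass

open Classical in
lemma degree_cases (hG : InClass G n k) (hk : 3 ≤ k) (hn : 2 ≤ n) (v : V) :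
    (IsCutVertex G v ∧ 4 ≤ G.degree v) ∨ (¬ IsCutVertex G v ∧ G.degree v = 2) := by
  have := hG.nontrivial hk (by omega)
  have h1 := hG.1.card_polygonsAt_pos hk v
  have h2 := hG.1.isCutVertex_iff hk (v := v)
  have h3 := hG.1.degree_eq hk v
  by_cases hc : IsCutVertex G v
  · exact .inl ⟨hc, by have := h2.1 hc; omega⟩
  · have : ¬ 2 ≤ #(polygonsAt G k v) := fun h => hc (h2.2 h)
    exact .inr ⟨hc, by omega⟩

-- With `p(v)` polygons at `v`, the bound `4p² ≥ 4(3p - 2)` is `(p - 1)(p - 2) ≥ 0`, true for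
-- integers and sharp for `p = 1, 2`. The linear side sums to `4(3nk - 2|V|)`.
open Classical in
lemma sum_degree_sq (hG : InClass G n k) (hk : 3 ≤ k) (hn : 2 ≤ n) :
    4 * ((n : ℝ) * k + 2 * n - 2) ≤ ∑ v, (G.degree v : ℝ) * G.degree v ∧
    (4 * ((n : ℝ) * k + 2 * n - 2) = ∑ v, (G.degree v : ℝ) * G.degree v ↔
      ∀ v, G.degree v ≤ 4) := by
  have := hG.nontrivial hk (by omega)
  have hdeg : ∀ v, (G.degree v : ℝ) = 2 * #(polygonsAt G k v) := fun v => by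
    rw [hG.1.degree_eq hk v]; push_cast; ring
  have hsum : ∑ v, (#(polygonsAt G k v) : ℝ) = n * k := by
    rw [← Nat.cast_sum, sum_card_polygonsAt hk, hG.card_polygons]
    push_cast; ring
  have hV : (Fintype.card V : ℝ) + n = n * k + 1 := by
    exact_mod_cast hG.card_vertices hk
  have hlin : 4 * ((n : ℝ) * k + 2 * n - 2) =
      ∑ v, 4 * (3 * (#(polygonsAt G k v) : ℝ) - 2) := by
    rw [← Finset.mul_sum, Finset.sum_sub_distrib, ← Finset.mul_sum, hsum, Finset.sum_const,
      Finset.card_univ, nsmul_eq_mul]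
    linarith
  have hle : ∀ v ∈ (Finset.univ : Finset V), 4 * (3 * (#(polygonsAt G k v) : ℝ) - 2) ≤
      (G.degree v : ℝ) * G.degree v := by
    intro v _
    rw [hdeg]
    have h1 : (1 : ℝ) ≤ #(polygonsAt G k v) := by
      exact_mod_cast hG.1.card_polygonsAt_pos hk v
    rcases le_or_gt 2 #(polygonsAt G k v) with h | h
    · have h2 : (2 : ℝ) ≤ #(polygonsAt G k v) := by exact_mod_cast h
      nlinarith
    · have h2 : (#(polygonsAt G k v) : ℝ) = 1 := by
        have := hG.1.card_polygonsAt_pos hk v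
        exact_mod_cast (by omega : #(polygonsAt G k v) = 1)
      rw [h2]; norm_num
  rw [hlin]
  refine ⟨Finset.sum_le_sum hle, ?_⟩
  rw [Finset.sum_eq_sum_iff_of_le hle]
  refine forall_congr' fun v => ?_
  have hpos := hG.1.card_polygonsAt_pos hk v
  rw [hdeg, hG.1.degree_eq hk]
  simp only [Finset.mem_univ, forall_true_left]
  constructor
  · intro h
    have h0 : ((#(polygonsAt G k v) : ℝ) - 1) * ((#(polygonsAt G k v) : ℝ) - 2) = 0 := by
      linarith
    rcases mul_eq_zero.1 h0 with h | h
    · have : (#(polygonsAt G k v) : ℝ) = 1 := by linarith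
      have : #(polygonsAt G k v) = 1 := by exact_mod_cast this
      omega
    · have : (#(polygonsAt G k v) : ℝ) = 2 := by linarith
      have : #(polygonsAt G k v) = 2 := by exact_mod_cast this
      omega
  · intro h
    rcases (by omega : #(polygonsAt G k v) = 1 ∨ #(polygonsAt G k v) = 2) with h | h <;>
    · rw [h]; norm_num

-- The linear parts `d(u) + d(v)` sum over the edges to `∑ d(v) ^ 2`. Equality is needed here only
-- for degrees at most 4; that the optimum forces such degrees comes from `sum_degree_sq`.
open Classical in
lemma le_sombor_of_degrees (hG : InClass G n k) (hk : 3 ≤ k) (hn : 2 ≤ n) {α : ℝ} (hα : 1 < α) :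
    (2 : ℝ) ^ (1 / α) / 2 * ∑ v, (G.degree v : ℝ) * G.degree v +
        excess α * ∑ C ∈ polygons G k, numMixed C ≤ sombor G α ∧
    ((∀ v, G.degree v ≤ 4) →
      (2 : ℝ) ^ (1 / α) / 2 * ∑ v, (G.degree v : ℝ) * G.degree v +
        excess α * ∑ C ∈ polygons G k, numMixed C = sombor G α) := by
  have hL : (2 : ℝ) ^ (1 / α) / 2 * ∑ v, (G.degree v : ℝ) * G.degree v +
        excess α * ∑ C ∈ polygons G k, numMixed C =
      ∑ e ∈ G.edgeFinset, ((2 : ℝ) ^ (1 / α) / 2 *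
        ∑ w, (if w ∈ e then (G.degree w : ℝ) else 0) +
          if IsMixed (IsCutVertex G) e then excess α else 0) := by
    rw [Finset.sum_add_distrib, ← Finset.mul_sum, sum_edgeFinset_sum_mem, ← Finset.sum_filter,
      Finset.sum_const, hG.card_mixed_eq hk, nsmul_eq_mul, mul_comm (excess α)]
  rw [hL, sombor]
  have hcases := hG.degree_cases hk hn
  constructor
  · refine Finset.sum_le_sum fun e he => ?_
    induction e with
    | h a b =>
      have hab : G.Adj a b := by simpa using he
      rw [sum_ite_mem_mk hab.ne, Sym2.lift_mk, isMixed_mk]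
      change _ ≤ pairNorm α (G.degree a) (G.degree b)
      rcases hcases a with ⟨ha, hda⟩ | ⟨ha, hda⟩ <;> rcases hcases b with ⟨hb, hdb⟩ | ⟨hb, hdb⟩
      · simpa [ha, hb] using le_pairNorm hα.le (Nat.cast_nonneg _) (Nat.cast_nonneg _)
      · simp only [ha, hb, hdb]
        rw [pairNorm_comm, add_comm (G.degree a : ℝ)]
        simpa using excess_le_pairNorm hα (by exact_mod_cast hda)
      · simp only [ha, hb, hda]
        simpa using excess_le_pairNorm hα (by exact_mod_cast hdb)
      · simpa [ha, hb] using le_pairNorm hα.le (Nat.cast_nonneg _) (Nat.cast_nonneg _)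
  · intro h4
    refine Finset.sum_congr rfl fun e he => ?_
    induction e with
    | h a b =>
      have hab : G.Adj a b := by simpa using he
      rw [sum_ite_mem_mk hab.ne, Sym2.lift_mk, isMixed_mk]
      change _ = pairNorm α (G.degree a) (G.degree b)
      have h4a := h4 a
      have h4b := h4 b
      rcases hcases a with ⟨ha, hda⟩ | ⟨ha, hda⟩ <;> rcases hcases b with ⟨hb, hdb⟩ | ⟨hb, hdb⟩
      · rw [show G.degree a = 4 by omega, show G.degree b = 4 by omega,
          pairNorm_self hα.le (by norm_num)]
        simp only [ha, hb]
        norm_num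
        ring
      · rw [show G.degree a = 4 by omega, hdb, pairNorm_comm]
        simp only [ha, hb, excess]
        norm_num
        ring
      · rw [show G.degree b = 4 by omega, hda]
        simp only [ha, hb, excess]
        norm_num
        ring
      · rw [hda, hdb, pairNorm_self hα.le (by norm_num)]
        simp only [ha, hb]
        norm_num
        ring

/-- The lower bound on the Sombor index in terms of an upper bound on the number of saturated
polygons, with its case of equality. -/
lemma le_sombor (hG : InClass G n k) (hk : 3 ≤ k) (hn : 2 ≤ n) {α : ℝ} (hα : 1 < α) {s : ℕ}
    (hs : numSaturated G k ≤ s) :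
    2 * (2 : ℝ) ^ (1 / α) * ((n : ℝ) * k + 2 * n - 2) + 2 * excess α * (n - s) ≤ sombor G α ∧
    (sombor G α = 2 * (2 : ℝ) ^ (1 / α) * ((n : ℝ) * k + 2 * n - 2) + 2 * excess α * (n - s) ↔
      IsChemicalCactus G n k ∧ numSaturated G k = s ∧
        ∀ C, IsPolygon G k C → CutVerticesConsecutive G k C) := by
  classical
  obtain ⟨h1, h1'⟩ := hG.le_sombor_of_degrees hk hn hα
  obtain ⟨h2, h2'⟩ := hG.sum_degree_sq hk hn
  obtain ⟨h3, h3'⟩ := hG.sum_numMixed_ge hk hn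
  have hA : 0 < (2 : ℝ) ^ (1 / α) := by positivity
  have hδ := excess_pos hα
  set M := ∑ C ∈ polygons G k, numMixed C
  set D := ∑ v, (G.degree v : ℝ) * G.degree v
  have h3r : 2 * (n : ℝ) ≤ M + 2 * numSaturated G k := by exact_mod_cast h3
  have hsr : (numSaturated G k : ℝ) ≤ s := by exact_mod_cast hs
  have hD := mul_le_mul_of_nonneg_left h2 hA.le
  have hM := mul_le_mul_of_nonneg_left h3r hδ.le
  have hS := mul_le_mul_of_nonneg_left hsr hδ.le
  refine ⟨by linarith, ?_, ?_⟩
  · intro heq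
    -- The bound adds up independent inequalities with positive factors, so overall equality makes
    -- each of them an equality.
    have e1 : (2 : ℝ) ^ (1 / α) * (4 * ((n : ℝ) * k + 2 * n - 2)) = (2 : ℝ) ^ (1 / α) * D := by
      linarith
    have e2 : excess α * (2 * (n : ℝ)) = excess α * (M + 2 * numSaturated G k) := by linarith
    have e3 : excess α * (numSaturated G k : ℝ) = excess α * s := by linarith
    refine ⟨⟨hG, fun v => ?_⟩, ?_, ?_⟩
    · convert h2'.1 (mul_left_cancel₀ hA.ne' e1) v
    · exact_mod_cast mul_left_cancel₀ hδ.ne' e3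
    · exact h3'.1 (by exact_mod_cast mul_left_cancel₀ hδ.ne' e2)
  · rintro ⟨⟨-, hchem⟩, hs', hcons⟩
    have hchem' : ∀ v, G.degree v ≤ 4 := fun v => by convert hchem v
    have e1 := h2'.2 hchem'
    have e2 : 2 * (n : ℝ) = M + 2 * numSaturated G k := by exact_mod_cast h3'.2 hcons
    have e0 := h1' hchem'
    rw [hs'] at e2
    have e3 : (M : ℝ) = 2 * n - 2 * s := by linarith
    rw [← e0, ← e1, e3]
    ring

end InClass

end Cactus

/-! ### The breadth-first cactus attaining the maximum -/

namespace Cactus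

open SimpleGraph
open scoped Finset

universe u

/-- The vertices of the breadth-first cactus with `n` polygons of length `m + 3`. -/
abbrev BfsVertex (n m : ℕ) : Type u := ULift.{u} (Fin (n * (m + 2) + 1))

namespace Bfs

variable {n m : ℕ}

/-- The position `i` on the polygon `j`: position `0` is an old vertex, the others are new. -/
def vertIdx (m j : ℕ) (i : Fin (m + 3)) : ℕ := if i = 0 then j - 1 else j * (m + 2) + i.val

lemma succ_mul_le {j l : ℕ} (h : j < l) (q : ℕ) : j * q + q ≤ l * q := by
  rw [← Nat.succ_mul]; exact Nat.mul_le_mul_right q h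

lemma vertIdx_lt (j : Fin n) (i : Fin (m + 3)) : vertIdx m j i < n * (m + 2) + 1 := by
  have h := succ_mul_le j.2 (m + 2)
  have h2 : j.val ≤ j.val * (m + 2) := Nat.le_mul_of_pos_right _ (by omega)
  have := i.2
  unfold vertIdx
  split_ifs <;> omega

/-- The vertex at position `i` of the polygon `j`. -/
def vert (j : Fin n) (i : Fin (m + 3)) : BfsVertex.{u} n m := ⟨⟨vertIdx m j i, vertIdx_lt j i⟩⟩

/-- The vertex `a` is new on the polygon `j`. -/
def Fresh (j : ℕ) (a : BfsVertex.{u} n m) : Prop :=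
  j * (m + 2) + 1 ≤ a.down.val ∧ a.down.val ≤ j * (m + 2) + (m + 2)

lemma Fresh.unique {j l : ℕ} {a : BfsVertex.{u} n m} (h : Fresh j a) (h' : Fresh l a) :
    j = l := by
  rcases lt_trichotomy j l with hjl | hjl | hjl
  · have := succ_mul_le hjl (m + 2)
    have := h.2
    have := h'.1
    omega
  · exact hjl
  · have := succ_mul_le hjl (m + 2)
    have := h.1
    have := h'.2
    omega

lemma fresh_div {a : BfsVertex.{u} n m} (h : a.down.val ≠ 0) :
    Fresh ((a.down.val - 1) / (m + 2)) a := by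
  have h1 := Nat.div_add_mod' (a.down.val - 1) (m + 2)
  have h2 := Nat.mod_lt (a.down.val - 1) (by omega : m + 2 > 0)
  constructor <;> omega

lemma Fresh.lt {j : ℕ} {a : BfsVertex.{u} n m} (h : Fresh j a) : j < n := by
  by_contra hn
  have h1 := Nat.mul_le_mul_right (m + 2) (not_lt.1 hn)
  have h2 := h.1
  have := a.down.2
  omega

/-- By truncated subtraction the polygons 0 and 1 both have the vertex 0 as their old vertex; from
then on each polygon is attached at the next vertex. -/
lemma mem_range_vert {j : Fin n} {a : BfsVertex.{u} n m} :
    a ∈ Set.range (vert j : Fin (m + 3) → BfsVertex.{u} n m) ↔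
      a.down.val = j.val - 1 ∨ Fresh j.val a := by
  constructor
  · rintro ⟨i, rfl⟩
    by_cases hi : i = 0
    · left; simp [vert, vertIdx, hi]
    · right
      have h0 : i.val ≠ 0 := fun h => hi (Fin.ext h)
      have := i.2
      simp only [Fresh, vert, vertIdx, if_neg hi]
      omega
  · rintro (h | h)
    · refine ⟨0, ULift.ext _ _ (Fin.ext ?_)⟩
      simp [vert, vertIdx, h]
    · obtain ⟨h1, h2⟩ := h
      refine ⟨⟨a.down.val - j.val * (m + 2), by omega⟩, ULift.ext _ _ (Fin.ext ?_)⟩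
      simp only [vert, vertIdx, Fin.ext_iff, Fin.val_zero]
      split_ifs with h <;> omega

lemma vert_injective (j : Fin n) :
    Function.Injective (vert j : Fin (m + 3) → BfsVertex.{u} n m) := by
  intro i l h
  have h' : vertIdx m j i = vertIdx m j l := by
    have := congrArg (fun a : BfsVertex.{u} n m => a.down.val) h
    simpa [vert] using this
  have h2 : j.val ≤ j.val * (m + 2) := Nat.le_mul_of_pos_right _ (by omega)
  unfold vertIdx at h'
  rw [Fin.ext_iff]
  split_ifs at h' with hi hl hl <;> simp only [Fin.ext_iff, Fin.val_zero] at hi hl <;> omega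

/-- Adjacency along the polygon `j`. -/
def PolyAdj (j : Fin n) (a b : BfsVertex.{u} n m) : Prop :=
  ∃ i, (vert j i = a ∧ vert j (i + 1) = b) ∨ (vert j (i + 1) = a ∧ vert j i = b)

lemma PolyAdj.symm {j : Fin n} {a b : BfsVertex.{u} n m} (h : PolyAdj j a b) : PolyAdj j b a := by
  obtain ⟨i, ⟨h1, h2⟩ | ⟨h1, h2⟩⟩ := h
  · exact ⟨i, .inr ⟨h2, h1⟩⟩
  · exact ⟨i, .inl ⟨h2, h1⟩⟩

lemma PolyAdj.ne {j : Fin n} {a b : BfsVertex.{u} n m} (h : PolyAdj j a b) : a ≠ b := by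
  rintro rfl
  obtain ⟨i, ⟨h1, h2⟩ | ⟨h2, h1⟩⟩ := h <;>
  · have := vert_injective j (h2.trans h1.symm)
    rw [add_eq_left] at this
    exact ne_of_beq_false rfl this

lemma PolyAdj.mem {j : Fin n} {a b : BfsVertex.{u} n m} (h : PolyAdj j a b) :
    a ∈ Set.range (vert j : Fin (m + 3) → BfsVertex.{u} n m) := by
  obtain ⟨i, ⟨rfl, -⟩ | ⟨rfl, -⟩⟩ := h
  · exact ⟨i, rfl⟩
  · exact ⟨i + 1, rfl⟩

variable (n m) in
/-- The breadth-first cactus: polygon `j + 1` is attached at the vertex `j`. -/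
def graph : SimpleGraph (BfsVertex.{u} n m) where
  Adj a b := ∃ j : Fin n, PolyAdj j a b
  symm := ⟨fun _ _ ⟨j, h⟩ => ⟨j, h.symm⟩⟩
  loopless := ⟨fun _ ⟨_, h⟩ => h.ne rfl⟩

/-- The polygon `j` of the breadth-first cactus. -/
def poly (j : Fin n) : (graph.{u} n m).Subgraph where
  verts := Set.range (vert j)
  Adj := PolyAdj j
  adj_sub h := ⟨j, h⟩
  edge_vert h := h.mem
  symm := ⟨fun _ _ h => h.symm⟩

lemma isNumbering_poly (j : Fin n) : IsNumbering (poly.{u} (m := m) j) (vert j) where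
  inj := vert_injective j
  verts := rfl
  adj _ _ := Iff.rfl

lemma isPolygon_poly (j : Fin n) : IsPolygon (graph.{u} n m) (m + 3) (poly j) :=
  isPolygon_iff_exists_isNumbering.2 ⟨_, isNumbering_poly j⟩

lemma mem_poly {j : Fin n} {a : BfsVertex.{u} n m} :
    a ∈ (poly j).verts ↔ a.down.val = j.val - 1 ∨ Fresh j.val a := mem_range_vert

lemma vertex_ext {a b : BfsVertex.{u} n m} (h : a.down.val = b.down.val) : a = b :=
  ULift.ext _ _ (Fin.ext h)

/-- The new vertices of the later polygon exceed every vertex of the earlier one, so only its old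
vertex can be shared. -/
lemma eq_of_mem_poly_of_lt {j l : Fin n} (hjl : j < l) {a b : BfsVertex.{u} n m}
    (haj : a ∈ (poly j).verts) (hal : a ∈ (poly l).verts)
    (hbj : b ∈ (poly j).verts) (hbl : b ∈ (poly l).verts) : a = b := by
  have key : ∀ x : BfsVertex.{u} n m, x ∈ (poly j).verts → x ∈ (poly l).verts →
      x.down.val = l.val - 1 := by
    intro x hxj hxl
    rw [mem_poly] at hxj hxl
    refine hxl.resolve_right fun hf => ?_
    have h1 := succ_mul_le (Fin.lt_def.1 hjl) (m + 2)
    have h2 : j.val ≤ j.val * (m + 2) := Nat.le_mul_of_pos_right _ (by omega)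
    have h3 := hf.1
    rcases hxj with h | h
    · omega
    · have := h.2
      omega
  exact vertex_ext ((key a haj hal).trans (key b hbj hbl).symm)

lemma eq_of_mem_poly {j l : Fin n} {a b : BfsVertex.{u} n m} (hab : a ≠ b)
    (haj : a ∈ (poly j).verts) (hal : a ∈ (poly l).verts)
    (hbj : b ∈ (poly j).verts) (hbl : b ∈ (poly l).verts) : j = l := by
  rcases lt_trichotomy j l with h | h | h
  · exact absurd (eq_of_mem_poly_of_lt h haj hal hbj hbl) hab
  · exact h
  · exact absurd (eq_of_mem_poly_of_lt h hal haj hbl hbj) hab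

lemma poly_injective : Function.Injective (poly : Fin n → (graph.{u} n m).Subgraph) := by
  intro j l h
  have hadj := (isNumbering_poly.{u} (m := m) j).adj_succ 0
  have hadj' := hadj
  rw [h] at hadj'
  exact eq_of_mem_poly hadj.ne hadj.fst_mem hadj'.fst_mem hadj.snd_mem hadj'.snd_mem

/-- A nonzero vertex is joined to the old vertex of the polygon on which it is new, and that vertex
has a smaller index. -/
lemma graph_connected : (graph.{u} n m).Connected := by
  let z : BfsVertex.{u} n m := ⟨0⟩
  have key : ∀ t, ∀ a : BfsVertex.{u} n m, a.down.val = t → (graph n m).Reachable a z := by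
    intro t
    induction t using Nat.strong_induction_on with
    | _ t ih =>
      intro a ha
      by_cases h0 : a.down.val = 0
      · rw [vertex_ext (a := a) (b := z) (by simpa [z] using h0)]
      · have hf := fresh_div h0
        have hlt : (a.down.val - 1) / (m + 2) < n := hf.lt
        set j : Fin n := ⟨_, hlt⟩
        have h1 : j.val ≤ j.val * (m + 2) := Nat.le_mul_of_pos_right _ (by omega)
        have h2 : j.val * (m + 2) + 1 ≤ a.down.val := hf.1
        have hroot : (vert.{u} j (0 : Fin (m + 3))).down.val = j.val - 1 := by
          simp [vert, vertIdx]
        refine Reachable.trans ?_ (ih _ ?_ (vert j 0) rfl)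
        · exact ((isPolygon_poly j).reachable (by omega) (mem_poly.2 (.inr hf))
            ⟨0, rfl⟩).mono (poly j).spanningCoe_le
        · rw [hroot]
          omega
  refine (connected_iff _).2 ⟨fun a b => ?_, ⟨z⟩⟩
  exact (key _ a rfl).trans (key _ b rfl).symm

/-- Let `a` be the vertex of `B` with the largest index, new on the polygon `j`. A walk in `B` that
avoids the old vertex of `j` could leave the new ones only through a later polygon, whose new
vertices have indices above that of `a`. -/
lemma exists_le_poly {B : (graph.{u} n m).Subgraph} (hB : IsTwoConnected B.coe) :
    ∃ j, B ≤ poly j := by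
  rw [isTwoConnected_coe_iff] at hB
  have hne : B.verts.Nonempty := by
    rw [← Set.encard_pos]
    exact lt_of_lt_of_le (by decide) hB.1
  obtain ⟨a, haB, hmax⟩ :=
    Set.exists_max_image B.verts (fun a => a.down.val) (Set.toFinite _) hne
  have ha0 : a.down.val ≠ 0 := by
    obtain ⟨b, hb, hba, -⟩ := exists_ne_ne_of_three_le_encard hB.1 a a
    intro h
    have := hmax b hb
    exact hba (vertex_ext (by omega))
  have hf := fresh_div ha0
  have hlt : (a.down.val - 1) / (m + 2) < n := hf.lt
  set j : Fin n := ⟨_, hlt⟩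
  have hf : Fresh j.val a := hf
  set r : BfsVertex.{u} n m := vert j 0
  have hroot : r.down.val = j.val - 1 := by simp [r, vert, vertIdx]
  have hj : j.val ≤ j.val * (m + 2) := Nat.le_mul_of_pos_right _ (by omega)
  have har : a ≠ r := by
    intro h
    rw [h] at hf
    have := hf.1
    omega
  have hverts : B.verts ⊆ (poly j).verts := by
    intro x hx
    rw [mem_poly]
    by_cases hxr : x = r
    · exact .inl (hxr ▸ hroot)
    · right
      refine (hB.2 r a x haB hx har hxr).mem_of_closed (S := {x | Fresh j.val x}) ?_ hf
      intro p q hpq hpr hqr hp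
      obtain ⟨l, hl⟩ := hpq.adj_sub
      have hpl := mem_poly.1 (hl.mem : p ∈ (poly l).verts)
      have hql := mem_poly.1 (hl.symm.mem : q ∈ (poly l).verts)
      have hqa := hmax q hpq.snd_mem
      have hp' : Fresh j.val p := hp
      rcases hpl with hpl | hpl
      · exfalso
        have h1 := hp'.1
        have h2 := succ_mul_le (by omega : j.val < l.val) (m + 2)
        have h3 := hf.2
        rcases hql with hql | hql
        · exact hl.ne (vertex_ext (hpl.trans hql.symm))
        · have := hql.1
          omega
      · have hjl := hp'.unique hpl
        rw [← hjl] at hql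
        rcases hql with hql | hql
        · exact absurd (vertex_ext (hql.trans hroot.symm)) hqr
        · exact hql
  refine ⟨j, hverts, fun p q hpq => ?_⟩
  obtain ⟨l, hl⟩ := hpq.adj_sub
  rw [eq_of_mem_poly hl.ne (hverts hpq.fst_mem) hl.mem (hverts hpq.snd_mem) hl.symm.mem]
  exact hl

lemma isPolygon_iff {C : (graph.{u} n m).Subgraph} :
    IsPolygon (graph n m) (m + 3) C ↔ ∃ j, poly j = C := by
  constructor
  · intro hC
    obtain ⟨j, hj⟩ := exists_le_poly (hC.isTwoConnected (by omega))
    exact ⟨j, (hC.eq_of_le (by omega) (by omega) (isPolygon_poly j) hj).symm⟩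
  · rintro ⟨j, rfl⟩
    exact isPolygon_poly j

lemma inClass : InClass (graph.{u} n m) n (m + 3) := by
  refine ⟨⟨graph_connected, ?_⟩, ?_⟩
  · rintro B (⟨u, v, ⟨j, huv⟩, hb, -⟩ | hB)
    · exact absurd hb (((isPolygon_poly j).isTwoConnected (by omega)).not_isBridge huv)
    · obtain ⟨j, hj⟩ := exists_le_poly hB.prop
      rw [hB.eq_of_le ((isPolygon_poly j).isTwoConnected (by omega)) hj]
      exact isPolygon_poly j
  · have : {C | IsPolygon (graph.{u} n m) (m + 3) C} = Set.range poly := by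
      ext C; exact isPolygon_iff
    rw [this, ← Set.image_univ, Set.ncard_image_of_injective _ poly_injective, Set.ncard_univ,
      Nat.card_fin]

lemma isChemicalCactus : IsChemicalCactus (graph.{u} n m) n (m + 3) := by
  classical
  refine ⟨inClass, fun v => ?_⟩
  rw [inClass.1.degree_eq (by omega)]
  -- Only two polygons can contain `v`: the one attached at it and the one on which it is new. For
  -- `v = 0` the quotient is 0, as it should be.
  have hsub : polygonsAt (graph.{u} n m) (m + 3) v ⊆ (Finset.univ.filter fun j : Fin n =>
      j.val ∈ ({v.down.val + 1, (v.down.val - 1) / (m + 2)} : Finset ℕ)).image poly := by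
    intro C hC
    rw [mem_polygonsAt, isPolygon_iff] at hC
    obtain ⟨⟨j, rfl⟩, hv⟩ := hC
    refine Finset.mem_image_of_mem _ ?_
    simp only [Finset.mem_filter, Finset.mem_univ, true_and, Finset.mem_insert,
      Finset.mem_singleton]
    rcases mem_poly.1 hv with h | h
    · by_cases hj : j.val = 0
      · right
        rw [h, hj]
        simp
      · left; omega
    · right
      refine h.unique (fresh_div ?_)
      have := h.1
      omega
  have h1 := (Finset.card_le_card hsub).trans Finset.card_image_le
  have h2 := Finset.card_le_card_of_injOn (s := Finset.univ.filter fun j : Fin n =>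
      j.val ∈ ({v.down.val + 1, (v.down.val - 1) / (m + 2)} : Finset ℕ))
      (t := {v.down.val + 1, (v.down.val - 1) / (m + 2)}) Fin.val
      (fun j hj => (Finset.mem_filter.1 hj).2) Fin.val_injective.injOn
  have h3 := Finset.card_le_two (a := v.down.val + 1) (b := (v.down.val - 1) / (m + 2))
  omega

lemma isCutVertex {v : BfsVertex.{u} n m} (hv : v.down.val + 1 < n) :
    IsCutVertex (graph.{u} n m) v := by
  have hdiv : (v.down.val - 1) / (m + 2) < v.down.val + 1 :=
    lt_of_le_of_lt (Nat.div_le_self _ _) (by omega)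
  refine inClass.1.isCutVertex_of_ne (by omega) (isPolygon_poly ⟨_, hv⟩)
    (isPolygon_poly ⟨_, hdiv.trans hv⟩) ?_ (mem_poly.2 (.inl (by simp))) (mem_poly.2 ?_)
  · intro h
    have := congrArg Fin.val (poly_injective h)
    simp only at this
    omega
  · by_cases h0 : v.down.val = 0
    · left; simp [h0]
    · exact .inr (fresh_div h0)

lemma le_numSaturated (hn : 2 ≤ n) :
    (n - 2) / (m + 2) ≤ numSaturated (graph.{u} n m) (m + 3) := by
  set s := (n - 2) / (m + 2)
  have hs : s * (m + 2) ≤ n - 2 := Nat.div_mul_le_self _ _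
  have hsn : s ≤ s * (m + 2) := Nat.le_mul_of_pos_right _ (by omega)
  let f : Fin s → (graph.{u} n m).Subgraph := fun j => poly ⟨j.val, by omega⟩
  have hf : Function.Injective f := by
    intro i j h
    have := congrArg Fin.val (poly_injective h)
    exact Fin.ext this
  have hcard : (Set.range f).ncard = s := by
    rw [← Set.image_univ, Set.ncard_image_of_injective _ hf, Set.ncard_univ, Nat.card_fin]
  rw [← hcard]
  refine Set.ncard_le_ncard ?_ (Set.toFinite _)
  rintro _ ⟨j, rfl⟩
  refine ⟨isPolygon_poly _, fun v hv => isCutVertex ?_⟩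
  -- The vertices of polygon `j < s` have indices at most `s * (m + 2) ≤ n - 2`, so a further
  -- polygon is attached at each of them.
  have h1 := succ_mul_le j.2 (m + 2)
  rcases mem_poly.1 hv with h | h
  · simp only at h
    omega
  · have := h.2
    simp only at this
    omega

end Bfs

/-- The largest number of saturated polygons is attained in every universe. -/
lemma exists_isChemicalCactus {n k : ℕ} (hn : 2 ≤ n) (hk : 3 ≤ k) :
    ∃ (W : Type u) (_ : Fintype W) (H : SimpleGraph W),
      IsChemicalCactus H n k ∧ (n - 2) / (k - 1) ≤ numSaturated H k := by
  obtain ⟨m, rfl⟩ := Nat.exists_eq_add_of_le' hk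
  exact ⟨BfsVertex.{u} n m, inferInstance, Bfs.graph n m, Bfs.isChemicalCactus,
    Bfs.le_numSaturated hn⟩

end Cactus

/-! ### The bound in closed form and the case of equality -/

namespace Cactus

lemma floor_div_eq {n k : ℕ} (hn : 2 ≤ n) (hk : 2 ≤ k) :
    (⌊((n : ℝ) - 2) / ((k : ℝ) - 1)⌋ : ℝ) = ((n - 2) / (k - 1) : ℕ) := by
  have h1 : (n : ℝ) - 2 = ((n - 2 : ℕ) : ℝ) := by push_cast [hn]; ring
  have h2 : (k : ℝ) - 1 = ((k - 1 : ℕ) : ℝ) := by push_cast [(by omega : 1 ≤ k)]; ring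
  rw [h1, h2, ← natCast_floor_eq_intCast_floor (by positivity), Nat.floor_div_natCast,
    Nat.floor_natCast]

lemma InClass.numSaturated_le {V : Type*} [Fintype V] {G : SimpleGraph V} {n k : ℕ}
    (hG : InClass G n k) (hk : 3 ≤ k) (hn : 2 ≤ n) :
    numSaturated G k ≤ (n - 2) / (k - 1) := by
  rw [Nat.le_div_iff_mul_le (by omega)]
  have := hG.numSaturated_mul_le hk hn
  omega

end Cactus

theorem theorem13 {V : Type*} [Fintype V] (G : SimpleGraph V) (n k : ℕ) (α : ℝ)
    (hn : 3 ≤ n) (hk : 3 ≤ k) (hα : 1 < α) (hG : Cactus.InClass G n k) :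
    (4 * (n : ℝ) - 4) * ((2 : ℝ) ^ α + (4 : ℝ) ^ α) ^ (1 / α)
        + 2 * ((n : ℝ) * (k : ℝ) - 4 * (n : ℝ) + 4) * (2 : ℝ) ^ (1 / α)
        + (6 * (2 : ℝ) ^ (1 / α) - 2 * ((2 : ℝ) ^ α + (4 : ℝ) ^ α) ^ (1 / α))
          * ((n : ℝ) - 2 + (⌊((n : ℝ) - 2) / ((k : ℝ) - 1)⌋ : ℝ))
      ≤ Cactus.sombor G α ∧
    (Cactus.sombor G α
        = (4 * (n : ℝ) - 4) * ((2 : ℝ) ^ α + (4 : ℝ) ^ α) ^ (1 / α)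
          + 2 * ((n : ℝ) * (k : ℝ) - 4 * (n : ℝ) + 4) * (2 : ℝ) ^ (1 / α)
          + (6 * (2 : ℝ) ^ (1 / α) - 2 * ((2 : ℝ) ^ α + (4 : ℝ) ^ α) ^ (1 / α))
            * ((n : ℝ) - 2 + (⌊((n : ℝ) - 2) / ((k : ℝ) - 1)⌋ : ℝ))
      ↔ Cactus.IsNiceSaturated G n k) := by
  open Cactus in
  have hbound : (4 * (n : ℝ) - 4) * ((2 : ℝ) ^ α + (4 : ℝ) ^ α) ^ (1 / α)
        + 2 * ((n : ℝ) * (k : ℝ) - 4 * (n : ℝ) + 4) * (2 : ℝ) ^ (1 / α)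
        + (6 * (2 : ℝ) ^ (1 / α) - 2 * ((2 : ℝ) ^ α + (4 : ℝ) ^ α) ^ (1 / α))
          * ((n : ℝ) - 2 + (⌊((n : ℝ) - 2) / ((k : ℝ) - 1)⌋ : ℝ)) =
      2 * (2 : ℝ) ^ (1 / α) * ((n : ℝ) * k + 2 * n - 2) +
        2 * excess α * (n - ((n - 2) / (k - 1) : ℕ)) := by
    rw [floor_div_eq (by omega) (by omega), excess, pairNorm]
    ring
  rw [hbound]
  obtain ⟨hle, heq⟩ := hG.le_sombor hk (by omega) hα (hG.numSaturated_le hk (by omega))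
  refine ⟨hle, heq.trans ⟨?_, ?_⟩⟩
  · rintro ⟨hchem, hs, hcons⟩
    exact ⟨hchem, fun W _ H hH => hs ▸ hH.1.numSaturated_le hk (by omega), hcons⟩
  · rintro ⟨hchem, hmax, hcons⟩
    -- Maximality is tested against the breadth-first cactus, built in the same universe as `V`.
    obtain ⟨W, hW, H, hH, hHs⟩ := Cactus.exists_isChemicalCactus (n := n) (by omega) hk
    exact ⟨hchem, le_antisymm (hG.numSaturated_le hk (by omega)) (hHs.trans (hmax W H hH)), hcons⟩
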